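/- Let $p_0\ge 1$ be a rational number with continued fraction $p_0=[\nu_0,\nu_1,\dots,\nu_\alpha]$, obtained from the Euclidean algorithm $p_1=1$, $\nu_i=\lfloor p_i/p_{i+1}\rfloor$, $p_{i+2}=p_i-\nu_ip_{i+1}$, which stops with $p_{\alpha+2}=0$ (so $\nu_\alpha\ge 2$ if $\alpha>0$). Define integers by $$y_{-1}=0,\ y_0=1,\ y_{i+1}=y_{i-1}+\nu_iy_i;\qquad z_{-1}=0,\ z_0=1,\ z_{i+1}=z_{i-1}+\nu_{i+1}z_i;\qquad m_0=0,\ m_{i+1}=m_i+\nu_i .$$ For $1\le j\le M:=m_{\alpha+1}$ let $r(j)=i$ if $i\le\alpha$ and $m_i\le j<m_{i+1}$, and $r(M)=\alpha+1$; put $\epsilon_j=(-1)^{r(j)}$ and $n_j=y_{i-1}+(j-m_i)y_i$ with $i=r(j)$. Let $C=(c_{ij})_{1\le i,j\le M}$ be the symmetric tridiagonal matrix with $c_{j-1,j}=c_{j,j-1}=(-1)^{r(j)-1}$, with $c_{MM}=(-1)^{\alpha+1}$ and, for $j<M$ and $i=r(j)$, with $c_{jj}=(-1)^i$ if $j=m_{i+1}-1$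 and $c_{jj}=2(-1)^i$ otherwise. Put $\Theta=C^{-1}$ and $B=2\Theta$. Fix $w\in\mathbb C$ with $\operatorname{Re}w<0$ and put $q=e^{w}$ and $q^x=e^{wx}$ for $x\in\mathbb Q$ (so $0<|q|<1$, and any branch of the fractional powers is allowed). Let $(a;q)_k=\prod_{i=0}^{k-1}(1-aq^i)$, and for integers $a,b$ let $\left[{a\atop b}\right]_q=\frac{(q;q)_a}{(q;q)_b(q;q)_{a-b}}$ if $0\le b\le a$, and $0$ otherwise. For $l\ge0$ let $$V_l^{(p_0)}(q)=\sum_{\lambda}\frac{q^{\frac12\widetilde\lambda B\widetilde\lambda^t}}{\prod_{j=1}^{M}(q^{\epsilon_j};q^{\epsilon_j})_{\lambda_j}},\qquad \widetilde\lambda_j=\epsilon_j\lambda_j,$$ the sum being over all $\lambda\in\mathbb Z_{\ge0}^{M}$ with $\sum_{k}n_k\lambda_k=l$. For a sign $\sigma=\pm1$ and integers $k,m$ let $$Q_{k,m}^{(\sigma)}(q)=q^{\frac{1-\sigma}{2}(k+m)}\left[{k-1\atop m}\right]_q+q^{\frac{1+\sigma}{2}(2k-m)}\left[{k-1\atop m-1}\right]_q,$$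 $$\Delta_\alpha(k,m)=\frac{1+(-1)^\alpha}{2}\binom{k-m}{2}+\frac{1-(-1)^\alpha}{2}\binom m2,$$ $$L_k^{(p_0)}(q)=\sum_{m\ge0}(-1)^mq^{m^2y_\alpha z_{\alpha-1}-km(y_{\alpha+1}z_{\alpha-1}+2y_\alpha z_{\alpha-1}+y_\alpha z_\alpha)+\Delta_\alpha(k,k-m)}\,Q_{k,k-m}^{((-1)^\alpha)}(q)$$ (the terms with $m>k$ vanish). Then both series below converge absolutely and $$\sum_{l\ge0}q^{l^2/p_0}V_l^{(p_0)}(q)=1+\sum_{k>0}(-1)^{\frac{1-(-1)^\alpha}{2}k}\,q^{k^2(y_{\alpha+1}+y_\alpha)(z_\alpha+z_{\alpha-1})}\,\frac{L_k^{(p_0)}(q)}{(q;q)_k}.$$ -/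

import Mathlib

namespace BetheRR

/-! ### The continued fraction of `p₀` and the attached integer sequences -/

/-- The remainders `p₀, p₁ = 1, p_{i+1} = p_{i-1} - ν_{i-1} p_i`, where
`ν_{i-1} = ⌊p_{i-1} / p_i⌋`, of the Euclidean algorithm. -/
def p (p₀ : ℚ) : ℕ → ℚ
  | 0 => p₀
  | 1 => 1
  | (i + 2) => p p₀ i - (⌊p p₀ i / p p₀ (i + 1)⌋₊ : ℚ) * p p₀ (i + 1)

/-- The partial quotients `ν_i = ⌊p_i / p_{i+1}⌋`, so `p₀ = [ν₀, ν₁, …, ν_α]`. -/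
def nu (p₀ : ℚ) (i : ℕ) : ℕ := ⌊p p₀ i / p p₀ (i + 1)⌋₊

/-- The index `α` of the last partial quotient of `p₀ = [ν₀, …, ν_α]`: the Euclidean algorithm
stops with `p_{α+2} = 0`. The set below is never empty for `1 ≤ p₀`, see `exists_p_eq_zero`. -/
noncomputable def alpha (p₀ : ℚ) : ℕ := sInf {i : ℕ | p p₀ (i + 2) = 0}

/-- `y₀ = 1`, `y₁ = ν₀`, `y_{i+1} = y_{i-1} + ν_i y_i`. -/
def y (p₀ : ℚ) : ℕ → ℕ
  | 0 => 1
  | 1 => nu p₀ 0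
  | (i + 2) => y p₀ i + nu p₀ (i + 1) * y p₀ (i + 1)

/-- `yPred p₀ i` is `y_{i-1}`, with `y_{-1} = 0`. -/
def yPred (p₀ : ℚ) : ℕ → ℕ
  | 0 => 0
  | (i + 1) => y p₀ i

/-- `z₀ = 1`, `z₁ = ν₁`, `z_{i+1} = z_{i-1} + ν_{i+1} z_i`. -/
def z (p₀ : ℚ) : ℕ → ℕ
  | 0 => 1
  | 1 => nu p₀ 1
  | (i + 2) => z p₀ i + nu p₀ (i + 2) * z p₀ (i + 1)

/-- `zPred p₀ i` is `z_{i-1}`, with `z_{-1} = 0`. -/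
def zPred (p₀ : ℚ) : ℕ → ℕ
  | 0 => 0
  | (i + 1) => z p₀ i

/-- `m₀ = 0`, `m_{i+1} = m_i + ν_i`. -/
def m (p₀ : ℚ) : ℕ → ℕ
  | 0 => 0
  | (i + 1) => m p₀ i + nu p₀ i

/-- `r(j) = i` if `m_i ≤ j < m_{i+1}` and `i ≤ α`, and `r(j) = α + 1` if `j ≥ m_{α+1}`. -/
noncomputable def r (p₀ : ℚ) (j : ℕ) : ℕ :=
  Nat.findGreatest (fun i => m p₀ i ≤ j) (alpha p₀ + 1)

/-- The piecewise linear function `n_j = y_{i-1} + (j - m_i) y_i`, `i = r(j)`. -/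
noncomputable def n (p₀ : ℚ) (j : ℕ) : ℕ :=
  yPred p₀ (r p₀ j) + (j - m p₀ (r p₀ j)) * y p₀ (r p₀ j)

/-! ### The matrix `Θ` -/

/-- The size `m_{α+1}` of the matrices. -/
noncomputable abbrev size (p₀ : ℚ) : ℕ := m p₀ (alpha p₀ + 1)

/-- The diagonal entries `c_{jj}`, for `1 ≤ j ≤ m_{α+1}`. -/
noncomputable def cDiag (p₀ : ℚ) (j : ℕ) : ℚ :=
  if j = size p₀ then (-1) ^ (alpha p₀ + 1)
  else if j + 1 = m p₀ (r p₀ j + 1) then (-1) ^ r p₀ j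
  else 2 * (-1) ^ r p₀ j

/-- The entries `c_{ij}`, for `1 ≤ i, j ≤ m_{α+1}`: tridiagonal and symmetric, with
`c_{j-1,j} = (-1)^{r(j)-1} = (-1)^{r(j)+1}`. -/
noncomputable def c (p₀ : ℚ) (i j : ℕ) : ℚ :=
  if i = j then cDiag p₀ j
  else if i + 1 = j then (-1) ^ (r p₀ j + 1)
  else if j + 1 = i then (-1) ^ (r p₀ i + 1)
  else 0

/-- The matrix `Θ⁻¹ = (c_{ij})`, `1 ≤ i, j ≤ m_{α+1}` (an index `j : Fin _` stands for `j + 1`). -/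
noncomputable def thetaInv (p₀ : ℚ) : Matrix (Fin (size p₀)) (Fin (size p₀)) ℚ :=
  Matrix.of fun i j => c p₀ ((i : ℕ) + 1) ((j : ℕ) + 1)

/-- The matrix `Θ`. -/
noncomputable def theta (p₀ : ℚ) : Matrix (Fin (size p₀)) (Fin (size p₀)) ℚ :=
  (thetaInv p₀)⁻¹

/-- `B = 2 Θ`. -/
noncomputable def B (p₀ : ℚ) : Matrix (Fin (size p₀)) (Fin (size p₀)) ℚ :=
  (2 : ℚ) • theta p₀

/-- The sign `ε_j = (-1)^{r(j)}` (an index `j : Fin _` stands for `j + 1`). -/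
noncomputable def eps (p₀ : ℚ) (j : Fin (size p₀)) : ℤ := (-1) ^ r p₀ ((j : ℕ) + 1)

/-! ### `q`-series. Throughout `q = e^w` with `Re w < 0`, and `q^x = e^{w x}` for rational `x` -/

/-- The power `q^x = e^{w x}` of `q = e^w`. -/
noncomputable def qPow (w : ℂ) (x : ℚ) : ℂ := Complex.exp (w * (x : ℂ))

/-- `(a; q)_k = ∏_{0 ≤ i < k} (1 - a q^i)`. -/
noncomputable def qPoch (a q : ℂ) (k : ℕ) : ℂ := ∏ i ∈ Finset.range k, (1 - a * q ^ i)

/-- The Gaussian `q`-binomial coefficient, zero unless `0 ≤ N ≤ M`. -/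
noncomputable def qBinom (q : ℂ) (M N : ℤ) : ℂ :=
  if 0 ≤ N ∧ N ≤ M then
    qPoch q q M.toNat / (qPoch q q N.toNat * qPoch q q (M - N).toNat)
  else 0

/-- The sequences `λ` of `m_{α+1}` non-negative integers with `∑ n_k λ_k = l`. The bound
`λ_k ≤ l` is no restriction, see `mem_configs`. -/
noncomputable def configs (p₀ : ℚ) (l : ℕ) : Finset (Fin (size p₀) → ℕ) :=
  (Fintype.piFinset fun _ => Finset.range (l + 1)).filter
    fun lam => ∑ k : Fin (size p₀), n p₀ ((k : ℕ) + 1) * lam k = l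

/-- `λ̃_j = (-1)^{r(j)} λ_j`. -/
noncomputable def tilde (p₀ : ℚ) (lam : Fin (size p₀) → ℕ) : Fin (size p₀) → ℚ :=
  fun j => (eps p₀ j : ℚ) * (lam j : ℚ)

/-- `V_l^{(p₀)}(q) = ∑_λ q^{½ λ̃ B λ̃ᵗ} / ∏_j (q^{ε_j}; q^{ε_j})_{λ_j}`. -/
noncomputable def V (p₀ : ℚ) (w : ℂ) (l : ℕ) : ℂ :=
  ∑ lam ∈ configs p₀ l,
    qPow w ((1 / 2 : ℚ) * (tilde p₀ lam ⬝ᵥ (B p₀).mulVec (tilde p₀ lam))) /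
      ∏ j, qPoch (qPow w (eps p₀ j)) (qPow w (eps p₀ j)) (lam j)

/-- `Q_{k,m}^{(σ)}(q)` for a sign `σ = ±1`:
`q^{(1-σ)(k+m)/2} [k-1, m]_q + q^{(1+σ)(2k-m)/2} [k-1, m-1]_q`. -/
noncomputable def Q (q : ℂ) (σ k m : ℤ) : ℂ :=
  q ^ ((1 - σ) / 2 * (k + m)) * qBinom q (k - 1) m +
    q ^ ((1 + σ) / 2 * (2 * k - m)) * qBinom q (k - 1) (m - 1)

/-- `Δ_a(k, m) = (1 + (-1)^a)/2 * binom(k-m, 2) + (1 - (-1)^a)/2 * binom(m, 2)`;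
all divisions are exact. -/
def Delta (a : ℕ) (k m : ℤ) : ℤ :=
  (1 + (-1) ^ a) / 2 * ((k - m) * (k - m - 1) / 2) + (1 - (-1) ^ a) / 2 * (m * (m - 1) / 2)

/-- `L_k^{(p₀)}(q)`. The terms with `m > k` of the sum over all `m ≥ 0` vanish,
see `Q_eq_zero`. -/
noncomputable def L (p₀ : ℚ) (q : ℂ) (k : ℕ) : ℂ :=
  ∑ m ∈ Finset.range (k + 1),
    (-1) ^ m *
      q ^ ((m : ℤ) ^ 2 * y p₀ (alpha p₀) * zPred p₀ (alpha p₀)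
        - (k : ℤ) * m * (y p₀ (alpha p₀ + 1) * zPred p₀ (alpha p₀)
            + 2 * y p₀ (alpha p₀) * zPred p₀ (alpha p₀)
            + y p₀ (alpha p₀) * z p₀ (alpha p₀))
        + Delta (alpha p₀) k (k - m)) *
      Q q ((-1) ^ alpha p₀) k (k - m)

/-! ### The facts quoted in the comments above -/

theorem Q_eq_zero (q : ℂ) (σ : ℤ) (k m : ℕ) (h : k < m) : Q q σ k ((k : ℤ) - m) = 0 := by
  have h1 : ¬ (0 ≤ (k : ℤ) - m ∧ (k : ℤ) - m ≤ k - 1) := by omega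
  have h2 : ¬ (0 ≤ (k : ℤ) - m - 1 ∧ (k : ℤ) - m - 1 ≤ k - 1) := by omega
  simp only [Q, qBinom, if_neg h1, if_neg h2, mul_zero, add_zero]

theorem exists_p_eq_zero (p₀ : ℚ) (hp₀ : 1 ≤ p₀) : {i : ℕ | p p₀ (i + 2) = 0}.Nonempty := by
  by_contra hne
  have hz : ∀ i, p p₀ (i + 2) ≠ 0 := fun i hi => hne ⟨i, hi⟩
  have hd : (0 : ℚ) < p₀.den := by exact_mod_cast p₀.den_pos
  -- all remainders are positive natural numbers over the denominator of the first one
  have key : ∀ i, 0 < p p₀ i ∧ 0 < p p₀ (i + 1) ∧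
      (∃ a : ℤ, p p₀ i * p₀.den = a) ∧ (∃ a : ℤ, p p₀ (i + 1) * p₀.den = a) := by
    intro i
    induction i with
    | zero =>
      refine ⟨by simp only [p]; linarith, by simp [p], ⟨p₀.num, ?_⟩, ⟨p₀.den, by simp [p]⟩⟩
      simp only [p]
      exact Rat.mul_den_eq_num p₀
    | succ i ih =>
      obtain ⟨h0, h1, ⟨a, ha⟩, ⟨b, hb⟩⟩ := ih
      refine ⟨h1, ?_, ⟨b, hb⟩, ?_⟩
      · have hle : (⌊p p₀ i / p p₀ (i + 1)⌋₊ : ℚ) ≤ p p₀ i / p p₀ (i + 1) :=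
          Nat.floor_le (by positivity)
        rw [le_div_iff₀ h1] at hle
        have : p p₀ (i + 2) = p p₀ i - (⌊p p₀ i / p p₀ (i + 1)⌋₊ : ℚ) * p p₀ (i + 1) := by
          simp only [p]
        have h3 : 0 ≤ p p₀ (i + 2) := by linarith
        exact lt_of_le_of_ne h3 (Ne.symm (hz i))
      · refine ⟨a - ⌊p p₀ i / p p₀ (i + 1)⌋₊ * b, ?_⟩
        have : p p₀ (i + 1 + 1) = p p₀ i - (⌊p p₀ i / p p₀ (i + 1)⌋₊ : ℚ) * p p₀ (i + 1) := by
          simp only [p]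
        rw [this]
        push_cast
        rw [← ha, ← hb]
        ring
  have hlt : ∀ i, p p₀ (i + 2) < p p₀ (i + 1) := by
    intro i
    obtain ⟨h0, h1, -, -⟩ := key i
    have := Nat.lt_floor_add_one (p p₀ i / p p₀ (i + 1))
    rw [div_lt_iff₀ h1] at this
    have h2 : p p₀ (i + 2) = p p₀ i - (⌊p p₀ i / p p₀ (i + 1)⌋₊ : ℚ) * p p₀ (i + 1) := by
      simp only [p]
    rw [h2]
    linarith
  have hN : ∀ i, ∃ a : ℕ, p p₀ (i + 1) * p₀.den = a := by
    intro i
    obtain ⟨-, h1, -, ⟨b, hb⟩⟩ := key i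
    have hb0 : (0 : ℚ) ≤ b := by rw [← hb]; positivity
    have hb1 : 0 ≤ b := by exact_mod_cast hb0
    refine ⟨b.toNat, ?_⟩
    rw [hb]
    exact_mod_cast (Int.toNat_of_nonneg hb1).symm
  choose f hf using hN
  have hdec : ∀ i, f (i + 1) < f i := by
    intro i
    have := mul_lt_mul_of_pos_right (hlt i) hd
    rw [hf i, hf (i + 1)] at this
    exact_mod_cast this
  have hsum : ∀ i, f i + i ≤ f 0 := by
    intro i
    induction i with
    | zero => simp
    | succ i ih => have := hdec i; omega
  have := hsum (f 0 + 1)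
  omega

theorem y_pos (p₀ : ℚ) (hp₀ : 1 ≤ p₀) (i : ℕ) : 0 < y p₀ i := by
  induction i using Nat.strong_induction_on with
  | _ i ih =>
    match i, ih with
    | 0, _ => simp [y]
    | 1, _ => simpa [y, nu, p, Nat.floor_pos] using hp₀
    | (i + 2), ih =>
      have := ih i (by omega)
      simp only [y]
      omega

theorem n_pos (p₀ : ℚ) (hp₀ : 1 ≤ p₀) (j : ℕ) (hj : 0 < j) : 0 < n p₀ j := by
  unfold n
  cases h : r p₀ j with
  | zero => simp [yPred, m, y]; omega
  | succ i => have := y_pos p₀ hp₀ i; simp only [yPred]; omega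

theorem mem_configs (p₀ : ℚ) (hp₀ : 1 ≤ p₀) (l : ℕ) (lam : Fin (size p₀) → ℕ) :
    lam ∈ configs p₀ l ↔ ∑ k : Fin (size p₀), n p₀ ((k : ℕ) + 1) * lam k = l := by
  simp only [configs, Finset.mem_filter, Fintype.mem_piFinset, Finset.mem_range,
    and_iff_right_iff_imp]
  intro h k
  have h1 : n p₀ ((k : ℕ) + 1) * lam k ≤ l := by
    rw [← h]
    exact Finset.single_le_sum (f := fun k : Fin (size p₀) => n p₀ ((k : ℕ) + 1) * lam k)
      (fun _ _ => Nat.zero_le _) (Finset.mem_univ k)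
  have h2 : lam k ≤ n p₀ ((k : ℕ) + 1) * lam k :=
    Nat.le_mul_of_pos_left _ (n_pos p₀ hp₀ _ (Nat.succ_pos _))
  omega

end BetheRR

open Finset

namespace BetheRR

/-! ### The finite `q`-binomial theorem -/

/-! Both sides are the same absolutely convergent double series over pairs `(a, b)` of natural
numbers, grouped in two ways: the left side by the value of `a Y + b Y'`, the right side by `k = a +
b`.

To reach the double series from the left, invert `C`. It is the matrix of a three-term recurrence
solved, up to the signs `ε_j`, by the numerators `n_j` and the interpolated denominators `d_j` of
the continued fraction. So `Θ` is a discrete Green function, `Θ_ij = ε_i ε_j n_min (d_max - n_max /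
p₀)` (`theta_apply`). The part with `1 / p₀` has rank one and contributes `-l² / p₀`, which the
prefactor `q^{l²/p₀}` cancels (`quadratic_form`). What remains is the integral form `∑ λ_i λ_j n_min
d_max`.

This form allows the variables `λ_1, λ_2, …` to be adjoined one at a time. The invariant is that the
sum over the first `j` variables is a two-dimensional sum `pairSum`, attached to two vectors `(Y,
Z)`, `(Y', Z')` with `Y Z' - Z Y' = 1`. Adjoining a variable attached to one of the two vectors
replaces that vector by the sum of both (`adjoin_pairSum_left`, `adjoin_pairSum_right`), a Farey
step proved by the finite `q`-binomial theorem. The factor `1 - q^b + q^(a+b)` is what reproduces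
itself under both steps. The weight with base `q⁻¹` moves the left vector and the weight with base
`q` the right one, so the signs `ε_j` follow the turns of the Farey path to `p₀` (`partialSum_eq`).
The path starts at `(1, 0)`, `(1, 1)`, whose sum is the indicator of `l = 0`.

On the right, `Q / (q; q)_k` is exactly the factor above over `(q; q)_a (q; q)_b` (`Q_one`,
`Q_neg_one`); the pair `(0, 0)` supplies the isolated `1`. -/

theorem qPoch_zero (a q : ℂ) : qPoch a q 0 = 1 := by simp [qPoch]

theorem qPoch_succ (a q : ℂ) (k : ℕ) : qPoch a q (k + 1) = qPoch a q k * (1 - a * q ^ k) :=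
  prod_range_succ _ _

theorem qPoch_succ' (a q : ℂ) (k : ℕ) : qPoch a q (k + 1) = (1 - a) * qPoch (a * q) q k := by
  unfold qPoch
  rw [prod_range_succ', mul_comm]
  simp [pow_succ', mul_assoc]

theorem one_sub_pow_ne_zero {q : ℂ} (hq : ‖q‖ < 1) (k : ℕ) : 1 - q ^ (k + 1) ≠ 0 := by
  intro h
  have h1 : q ^ (k + 1) = 1 := (sub_eq_zero.mp h).symm
  have h2 : ‖q‖ ^ (k + 1) < 1 := pow_lt_one₀ (norm_nonneg _) hq (Nat.succ_ne_zero _)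
  rw [← norm_pow, h1] at h2
  simp at h2

theorem qPoch_self_succ (q : ℂ) (k : ℕ) : qPoch q q (k + 1) = qPoch q q k * (1 - q ^ (k + 1)) := by
  rw [qPoch_succ, pow_succ']

theorem qPoch_self_ne_zero {q : ℂ} (hq : ‖q‖ < 1) (k : ℕ) : qPoch q q k ≠ 0 := by
  induction k with
  | zero => simp [qPoch_zero]
  | succ k ih => rw [qPoch_self_succ]; exact mul_ne_zero ih (one_sub_pow_ne_zero hq k)

theorem qPoch_inv {q : ℂ} (hq0 : q ≠ 0) (k : ℕ) :
    qPoch q⁻¹ q⁻¹ k * q ^ (k + 1).choose 2 = (-1) ^ k * qPoch q q k := by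
  induction k with
  | zero => simp [qPoch_zero]
  | succ k ih =>
    have hc : (k + 1 + 1).choose 2 = (k + 1).choose 2 + (k + 1) := by
      rw [Nat.choose_succ_succ' (k + 1) 1, Nat.choose_one_right, add_comm]
    have h1 : q⁻¹ * q⁻¹ ^ k * q ^ (k + 1) = 1 := by
      rw [← pow_succ', ← mul_pow, inv_mul_cancel₀ hq0, one_pow]
    rw [qPoch_succ, qPoch_self_succ, hc, pow_add, pow_succ (-1 : ℂ)]
    linear_combination (1 - q⁻¹ * q⁻¹ ^ k) * q ^ (k + 1) * ih -
      (-1) ^ k * qPoch q q k * h1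

/-- The finite `q`-binomial theorem. -/
theorem sum_antidiagonal_qPoch {q : ℂ} (hq : ‖q‖ < 1) (A : ℕ) (x : ℂ) :
    ∑ p ∈ antidiagonal A, (-1) ^ p.1 * q ^ p.1.choose 2 * x ^ p.1 /
      (qPoch q q p.1 * qPoch q q p.2) = qPoch x q A / qPoch q q A := by
  induction A generalizing x with
  | zero => simp [qPoch_zero]
  | succ A ih =>
    have hA := one_sub_pow_ne_zero hq A
    rw [eq_div_iff (qPoch_self_ne_zero hq _), qPoch_self_succ, qPoch_succ']
    have key : (∑ p ∈ antidiagonal (A + 1), (-1) ^ p.1 * q ^ p.1.choose 2 * x ^ p.1 /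
        (qPoch q q p.1 * qPoch q q p.2)) * (1 - q ^ (A + 1)) =
        (1 - x) * (qPoch (x * q) q A / qPoch q q A) := by
      rw [← ih (x * q)]
      -- This is `1 - q^(A+1) = (1 - q^i) + q^i (1 - q^j)` for `i + j = A + 1`. Each part cancels
      -- one factor of a denominator and leaves the sum for `A` at `x q`, with coefficients `-x` and
      -- `1`.
      have hsplit : (∑ p ∈ antidiagonal (A + 1), (-1) ^ p.1 * q ^ p.1.choose 2 * x ^ p.1 /
          (qPoch q q p.1 * qPoch q q p.2)) * (1 - q ^ (A + 1)) =
          (∑ p ∈ antidiagonal (A + 1), (1 - q ^ p.1) * ((-1) ^ p.1 * q ^ p.1.choose 2 * x ^ p.1 /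
            (qPoch q q p.1 * qPoch q q p.2))) +
          ∑ p ∈ antidiagonal (A + 1), q ^ p.1 * (1 - q ^ p.2) *
            ((-1) ^ p.1 * q ^ p.1.choose 2 * x ^ p.1 / (qPoch q q p.1 * qPoch q q p.2)) := by
        rw [sum_mul, ← sum_add_distrib]
        refine sum_congr rfl fun p hp => ?_
        rw [← HasAntidiagonal.mem_antidiagonal.mp hp, pow_add]
        ring
      rw [hsplit, Finset.Nat.sum_antidiagonal_succ, Finset.Nat.sum_antidiagonal_succ']
      simp only [pow_zero, sub_self, zero_mul, mul_zero, zero_add]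
      rw [sub_mul, one_mul, add_comm, sub_eq_add_neg]
      congr 1
      · refine sum_congr rfl fun p _ => ?_
        rw [qPoch_self_succ]
        have h1 := one_sub_pow_ne_zero hq p.2
        have h2 := qPoch_self_ne_zero hq p.1
        have h3 := qPoch_self_ne_zero hq p.2
        rw [mul_pow]
        field_simp
      · rw [mul_sum, ← sum_neg_distrib]
        refine sum_congr rfl fun p _ => ?_
        rw [qPoch_self_succ]
        have h1 := one_sub_pow_ne_zero hq p.1
        have h2 := qPoch_self_ne_zero hq p.1
        have h3 := qPoch_self_ne_zero hq p.2
        have hc : (p.1 + 1).choose 2 = p.1.choose 2 + p.1 := by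
          rw [Nat.choose_succ_succ' p.1 1, Nat.choose_one_right, add_comm]
        generalize 1 - q ^ (p.1 + 1) = u at h1 ⊢
        rw [mul_pow, hc, pow_add q, pow_succ (-1 : ℂ), pow_succ x]
        field_simp
    rw [mul_comm (qPoch q q A), ← mul_assoc, key, mul_assoc,
      div_mul_cancel₀ _ (qPoch_self_ne_zero hq _)]

theorem qPoch_inv_pow {q : ℂ} (hq0 : q ≠ 0) (A d : ℕ) :
    qPoch (q⁻¹ ^ (A + d)) q A * qPoch q q d * q ^ ((A + d) * A) =
      (-1) ^ A * q ^ A.choose 2 * qPoch q q (A + d) := by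
  induction A generalizing d with
  | zero => simp [qPoch_zero]
  | succ A ih =>
    have h := ih (d + 1)
    have hc : (A + 1).choose 2 = A.choose 2 + A := by
      rw [Nat.choose_succ_succ' A 1, Nat.choose_one_right, add_comm]
    have e : A + (d + 1) = A + 1 + d := by ring
    rw [e, qPoch_self_succ] at h
    have h1 : q⁻¹ ^ (A + 1 + d) * q ^ A * q ^ (d + 1) = 1 := by
      rw [mul_assoc, ← pow_add, show A + (d + 1) = A + 1 + d by ring, ← mul_pow,
        inv_mul_cancel₀ hq0, one_pow]
    rw [qPoch_succ, hc, pow_add q, pow_succ (-1 : ℂ), mul_add, mul_one, pow_add q]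
    have h2 : q ^ (A + 1 + d) = q ^ A * q ^ (d + 1) := by rw [← pow_add]; congr 1; ring
    linear_combination (-q ^ A) * h +
      qPoch (q⁻¹ ^ (A + 1 + d)) q A * qPoch q q d * q ^ ((A + 1 + d) * A) *
        ((1 - q⁻¹ ^ (A + 1 + d) * q ^ A) * h2 - q ^ A * h1)

/-- This vanishing truncates the summed series to `A ≤ b`, so that `b - A` can serve as the new
summation variable. -/
theorem qPoch_inv_pow_eq_zero {q : ℂ} (hq0 : q ≠ 0) {A b : ℕ} (h : b < A) :
    qPoch (q⁻¹ ^ b) q A = 0 := by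
  refine prod_eq_zero (mem_range.mpr h) ?_
  rw [← mul_pow, inv_mul_cancel₀ hq0, one_pow, sub_self]

theorem one_sub_mul_qPoch {q : ℂ} (hq0 : q ≠ 0) (A b : ℕ) :
    (1 - q ^ b) * qPoch (q⁻¹ ^ b * q) q A =
      qPoch (q⁻¹ ^ b) q A * (q ^ A - q ^ b) := by
  have h := (qPoch_succ' (q⁻¹ ^ b) q A).symm.trans (qPoch_succ _ _ _)
  have h1 : q⁻¹ ^ b * q ^ b = 1 := by rw [← mul_pow, inv_mul_cancel₀ hq0, one_pow]
  linear_combination (-q ^ b) * h + (-qPoch (q⁻¹ ^ b * q) q A + qPoch (q⁻¹ ^ b) q A * q ^ A) * h1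

/-! ### The two-dimensional sums -/

/-- The pairs `(a, b)` with `a Y + b W = l`, for positive `Y` and `W`. -/
def pairs (Y W l : ℕ) : Finset (ℕ × ℕ) :=
  (range (l + 1) ×ˢ range (l + 1)).filter fun x => x.1 * Y + x.2 * W = l

theorem mem_pairs {Y W l : ℕ} (hY : 0 < Y) (hW : 0 < W) (x : ℕ × ℕ) :
    x ∈ pairs Y W l ↔ x.1 * Y + x.2 * W = l := by
  simp only [pairs, mem_filter, mem_product, mem_range, and_iff_right_iff_imp]
  rintro rfl
  have h1 := Nat.le_mul_of_pos_right x.1 hY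
  have h2 := Nat.le_mul_of_pos_right x.2 hW
  omega

theorem sum_pairs_swap {Y W : ℕ} (l : ℕ) (F : ℕ → ℕ → ℂ) :
    ∑ x ∈ pairs Y W l, F x.1 x.2 = ∑ x ∈ pairs W Y l, F x.2 x.1 := by
  refine sum_nbij' Prod.swap Prod.swap ?_ ?_ ?_ ?_ ?_ <;>
    simp +contextual [pairs, add_comm]

/-- A new variable `c` attached to the same `Y` as `a` enters the constraint only through `A = a +
c`; the inner sum on the right is then over the splittings of `A`. -/
theorem sum_pairs_pairs {Y W : ℕ} (hY : 0 < Y) (hW : 0 < W) (l : ℕ) (F : ℕ → ℕ → ℕ → ℂ) :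
    ∑ x ∈ pairs Y 1 l, ∑ s ∈ pairs Y W x.2, F x.1 s.1 s.2 =
      ∑ t ∈ pairs Y W l, ∑ s ∈ antidiagonal t.1, F s.1 s.2 t.2 := by
  rw [sum_sigma', sum_sigma']
  refine sum_nbij' (fun x => ⟨(x.1.1 + x.2.1, x.2.2), (x.1.1, x.2.1)⟩)
    (fun x => ⟨(x.2.1, x.2.2 * Y + x.1.2 * W), (x.2.2, x.1.2)⟩) ?_ ?_ ?_ ?_ ?_
  · rintro ⟨⟨c, l'⟩, ⟨a, b⟩⟩ h
    simp only [mem_sigma, mem_pairs hY one_pos, mem_pairs hY hW, HasAntidiagonal.mem_antidiagonal] at h ⊢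
    refine ⟨?_, trivial⟩
    rw [add_mul]; omega
  · rintro ⟨⟨A, b⟩, ⟨c, a⟩⟩ h
    simp only [mem_sigma, mem_pairs hY one_pos, mem_pairs hY hW, HasAntidiagonal.mem_antidiagonal] at h ⊢
    obtain ⟨h1, rfl⟩ := h
    rw [add_mul] at h1
    exact ⟨by omega, trivial⟩
  · rintro ⟨⟨c, l'⟩, ⟨a, b⟩⟩ h
    simp only [mem_sigma, mem_pairs hY one_pos, mem_pairs hY hW] at h
    obtain ⟨-, h⟩ := h
    simp [h]
  · rintro ⟨⟨A, b⟩, ⟨c, a⟩⟩ h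
    simp only [mem_sigma, HasAntidiagonal.mem_antidiagonal] at h
    obtain ⟨-, h⟩ := h
    simp [h]
  · rintro ⟨⟨c, l'⟩, ⟨a, b⟩⟩ -
    rfl

/-- The sum over `(a, b)` with `a (Y + W) + b W = l` as a sum over `(a, a + b)`. -/
theorem sum_pairs_add {Y W : ℕ} (hY : 0 < Y) (hW : 0 < W) (l : ℕ) (F : ℕ → ℕ → ℂ) :
    ∑ x ∈ pairs (Y + W) W l, F x.1 x.2 =
      ∑ x ∈ pairs Y W l, if x.1 ≤ x.2 then F x.1 (x.2 - x.1) else 0 := by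
  rw [← sum_filter]
  refine sum_nbij' (fun x => (x.1, x.1 + x.2)) (fun x => (x.1, x.2 - x.1)) ?_ ?_ ?_ ?_ ?_
  · rintro ⟨a, b⟩ h
    simp only [mem_filter, mem_pairs (Nat.add_pos_left hY W) hW, mem_pairs hY hW] at h ⊢
    refine ⟨?_, Nat.le_add_right _ _⟩
    rw [← h]; ring
  · rintro ⟨a, b⟩ h
    simp only [mem_filter, mem_pairs (Nat.add_pos_left hY W) hW, mem_pairs hY hW] at h ⊢
    obtain ⟨h1, h2⟩ := h
    obtain ⟨d, rfl⟩ := Nat.exists_eq_add_of_le h2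
    rw [← h1, Nat.add_sub_cancel_left]; ring
  · rintro ⟨a, b⟩ -
    simp
  · rintro ⟨a, b⟩ h
    simp only [mem_filter] at h
    ext <;> simp only
    omega
  · rintro ⟨a, b⟩ -
    simp

/-- The coefficient of the pair `(a, b)` in the two-dimensional sum attached to the
vectors `(Y, Z)` and `(Y', Z')`. -/
noncomputable def pairTerm (q : ℂ) (Y Z Y' Z' a b : ℕ) : ℂ :=
  (-1) ^ b * q ^ (b.choose 2 + (a * Y + b * Y') * (a * Z + b * Z')) * (1 - q ^ b + q ^ (a + b)) /
    (qPoch q q a * qPoch q q b)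

/-- The two-dimensional sum attached to the vectors `(Y, Z)` and `(Y', Z')`. -/
noncomputable def pairSum (q : ℂ) (Y Z Y' Z' l : ℕ) : ℂ :=
  ∑ x ∈ pairs Y Y' l, pairTerm q Y Z Y' Z' x.1 x.2

/-- Adjoining one more summation variable `c`, attached to the vector `(Y, Z)`. -/
noncomputable def adjoin (q : ℂ) (g : ℕ → ℂ) (Y Z : ℕ) (f : ℕ → ℂ) (l : ℕ) : ℂ :=
  ∑ x ∈ pairs Y 1 l, g x.1 * q ^ (Z * x.1 * (Y * x.1 + 2 * x.2)) * f x.2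

/-- With `A = a + c` fixed, the determinant condition leaves only `-b c` as the dependence of the
quadratic exponent on `c`. The sum over `c` is then two `q`-binomial sums, at `x = q^(1-b)` and `x =
q^(-b)`. They combine to `(q^(-b); q)_A (q^A - q^b + q^(A+b))`, which is the old three-term factor
at `(A, b - A)` times `q^A (q^(-b); q)_A`. -/
theorem adjoin_pairSum_left {q : ℂ} (hq : ‖q‖ < 1) (hq0 : q ≠ 0) {Y Z Y' Z' : ℕ} (hY : 0 < Y)
    (hY' : 0 < Y') (hdet : Y * Z' = Z * Y' + 1) (l : ℕ) :
    adjoin q (fun c => (qPoch q⁻¹ q⁻¹ c)⁻¹) Y Z (pairSum q Y Z Y' Z') l =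
      pairSum q (Y + Y') (Z + Z') Y' Z' l := by
  unfold pairSum
  rw [sum_pairs_add hY hY']
  simp only [adjoin, mul_sum]
  have e : ∀ x ∈ pairs Y 1 l, ∑ s ∈ pairs Y Y' x.2,
      (qPoch q⁻¹ q⁻¹ x.1)⁻¹ * q ^ (Z * x.1 * (Y * x.1 + 2 * x.2)) *
        pairTerm q Y Z Y' Z' s.1 s.2 = ∑ s ∈ pairs Y Y' x.2,
      (qPoch q⁻¹ q⁻¹ x.1)⁻¹ * q ^ (Z * x.1 * (Y * x.1 + 2 * (s.1 * Y + s.2 * Y'))) *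
        pairTerm q Y Z Y' Z' s.1 s.2 := by
    intro x _
    refine sum_congr rfl fun s hs => ?_
    rw [(mem_pairs hY hY' s).mp hs]
  rw [sum_congr rfl e, sum_pairs_pairs hY hY' l (fun c a b =>
      (qPoch q⁻¹ q⁻¹ c)⁻¹ * q ^ (Z * c * (Y * c + 2 * (a * Y + b * Y'))) *
        pairTerm q Y Z Y' Z' a b)]
  refine sum_congr rfl fun t _ => ?_
  obtain ⟨A, b⟩ := t
  simp only
  have hb1 : q⁻¹ ^ b * q ^ b = 1 := by rw [← mul_pow, inv_mul_cancel₀ hq0, one_pow]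
  set X := (A * Y + b * Y') * (A * Z + b * Z') with hX
  have hterm : ∀ s ∈ antidiagonal A, (qPoch q⁻¹ q⁻¹ s.1)⁻¹ *
      q ^ (Z * s.1 * (Y * s.1 + 2 * (s.2 * Y + b * Y'))) * pairTerm q Y Z Y' Z' s.2 b =
      (-1) ^ b * q ^ (b.choose 2 + X) / qPoch q q b *
      ((1 - q ^ b) * ((-1) ^ s.1 * q ^ s.1.choose 2 * (q⁻¹ ^ b * q) ^ s.1 /
        (qPoch q q s.1 * qPoch q q s.2)) +
      q ^ (A + b) * ((-1) ^ s.1 * q ^ s.1.choose 2 * (q⁻¹ ^ b) ^ s.1 /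
        (qPoch q q s.1 * qPoch q q s.2))) := by
    rintro ⟨c, a⟩ hs
    obtain rfl : c + a = A := HasAntidiagonal.mem_antidiagonal.mp hs
    simp only
    have hexp : Z * c * (Y * c + 2 * (a * Y + b * Y')) + (a * Y + b * Y') * (a * Z + b * Z') +
        b * c = X := by
      have h : (Y * Z' : ℤ) = Z * Y' + 1 := by exact_mod_cast hdet
      rw [hX]
      zify
      linear_combination (-b * c : ℤ) * h
    have hP : (qPoch q⁻¹ q⁻¹ c)⁻¹ = (-1) ^ c * q ^ (c + 1).choose 2 / qPoch q q c := by
      have h := qPoch_inv hq0 c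
      have h1 : qPoch q⁻¹ q⁻¹ c ≠ 0 := by
        intro h0
        rw [h0, zero_mul] at h
        exact mul_ne_zero (pow_ne_zero _ (by norm_num)) (qPoch_self_ne_zero hq c) h.symm
      have h2 : ((-1 : ℂ) ^ c) * (-1) ^ c = 1 := by rw [← mul_pow]; simp
      rw [inv_eq_iff_eq_inv, inv_div, eq_div_iff (mul_ne_zero (pow_ne_zero _ (by norm_num))
        (pow_ne_zero _ hq0))]
      linear_combination (-1) ^ c * h + qPoch q q c * h2
    have hc : (c + 1).choose 2 = c.choose 2 + c := by
      rw [Nat.choose_succ_succ' c 1, Nat.choose_one_right, add_comm]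
    have hbc : (q⁻¹ ^ b) ^ c * q ^ (b * c) = 1 := by
      rw [pow_mul, ← mul_pow, hb1, one_pow]
    have h2 := qPoch_self_ne_zero hq a
    have h3 := qPoch_self_ne_zero hq b
    have h4 := qPoch_self_ne_zero hq c
    rw [hP, pairTerm, ← hexp, hc, mul_pow]
    simp only [pow_add q]
    have hbc' : (q⁻¹ ^ b) ^ c = (q ^ (b * c))⁻¹ := eq_inv_of_mul_eq_one_left hbc
    rw [hbc']
    have h5 : q ^ (b * c) ≠ 0 := pow_ne_zero _ hq0
    field_simp
  rw [sum_congr rfl hterm, ← mul_sum, sum_add_distrib, ← mul_sum, ← mul_sum,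
    sum_antidiagonal_qPoch hq, sum_antidiagonal_qPoch hq, mul_div_assoc', one_sub_mul_qPoch hq0]
  split_ifs with hAb
  · obtain ⟨d, rfl⟩ := Nat.exists_eq_add_of_le hAb
    rw [Nat.add_sub_cancel_left]
    have h1 := qPoch_inv_pow hq0 A d
    have hX' : (A * (Y + Y') + d * Y') * (A * (Z + Z') + d * Z') = X := by rw [hX]; ring
    have h2 := qPoch_self_ne_zero hq A
    have h3 := qPoch_self_ne_zero hq d
    have h4 := qPoch_self_ne_zero hq (A + d)
    have hc : (A + d).choose 2 + A.choose 2 + A = d.choose 2 + (A + d) * A := by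
      have key : ∀ n : ℕ, ((n.choose 2 : ℕ) : ℚ) = n * (n - 1) / 2 := fun n => Nat.cast_choose_two ℚ n
      have : (((A + d).choose 2 + A.choose 2 + A : ℕ) : ℚ) = (d.choose 2 + (A + d) * A : ℕ) := by
        push_cast [key]; ring
      exact_mod_cast this
    have h5 : q ^ ((A + d) * A) ≠ 0 := pow_ne_zero _ hq0
    have h6 : qPoch (q⁻¹ ^ (A + d)) q A =
        (-1) ^ A * q ^ A.choose 2 * qPoch q q (A + d) / (qPoch q q d * q ^ ((A + d) * A)) := by
      rw [eq_div_iff (mul_ne_zero h3 h5), ← h1]; ring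
    have h7 : q ^ (A + d).choose 2 * q ^ A.choose 2 * q ^ A = q ^ d.choose 2 * q ^ ((A + d) * A) := by
      rw [← pow_add, ← pow_add, ← pow_add, hc]
    have h8 : ((-1 : ℂ) ^ A) * (-1) ^ A = 1 := by rw [← mul_pow]; simp
    rw [pairTerm, hX', h6]
    simp only [pow_add]
    field_simp
    linear_combination (1 - q ^ d + q ^ A * q ^ d) *
      ((-1 : ℂ) ^ A * (-1) ^ A * h7 + q ^ d.choose 2 * q ^ ((A + d) * A) * h8)
  · rw [qPoch_inv_pow_eq_zero hq0 (not_le.mp hAb)]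
    simp

/-- The mirror computation with `B = b + c` fixed: the exponent now depends on the splitting through
`+c a`, and the two sums combine to `(q^(-a); q)_B (1 - q^B + q^a)`, the three-term factor at `(a -
B, B)`. -/
theorem adjoin_pairSum_right {q : ℂ} (hq : ‖q‖ < 1) (hq0 : q ≠ 0) {Y Z Y' Z' : ℕ} (hY : 0 < Y)
    (hY' : 0 < Y') (hdet : Y * Z' = Z * Y' + 1) (l : ℕ) :
    adjoin q (fun c => (qPoch q q c)⁻¹) Y' Z' (pairSum q Y Z Y' Z') l =
      pairSum q Y Z (Y + Y') (Z + Z') l := by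
  have hswap : pairSum q Y Z (Y + Y') (Z + Z') l =
      ∑ x ∈ pairs (Y' + Y) Y l, pairTerm q Y Z (Y + Y') (Z + Z') x.2 x.1 := by
    rw [add_comm Y' Y]
    exact sum_pairs_swap l fun a b => pairTerm q Y Z (Y + Y') (Z + Z') a b
  rw [hswap, sum_pairs_add hY' hY l fun b a => pairTerm q Y Z (Y + Y') (Z + Z') a b]
  simp only [adjoin, pairSum]
  have e : ∀ x ∈ pairs Y' 1 l, (qPoch q q x.1)⁻¹ * q ^ (Z' * x.1 * (Y' * x.1 + 2 * x.2)) *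
      ∑ s ∈ pairs Y Y' x.2, pairTerm q Y Z Y' Z' s.1 s.2 = ∑ s ∈ pairs Y' Y x.2,
      (qPoch q q x.1)⁻¹ * q ^ (Z' * x.1 * (Y' * x.1 + 2 * (s.2 * Y + s.1 * Y'))) *
        pairTerm q Y Z Y' Z' s.2 s.1 := by
    intro x _
    rw [sum_pairs_swap x.2 fun a b => pairTerm q Y Z Y' Z' a b, mul_sum]
    refine sum_congr rfl fun s hs => ?_
    rw [← (mem_pairs hY' hY s).mp hs, add_comm (s.1 * Y')]
  rw [sum_congr rfl e, sum_pairs_pairs hY' hY l (fun c b a =>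
      (qPoch q q c)⁻¹ * q ^ (Z' * c * (Y' * c + 2 * (a * Y + b * Y'))) *
        pairTerm q Y Z Y' Z' a b)]
  refine sum_congr rfl fun t _ => ?_
  obtain ⟨B, a⟩ := t
  simp only
  set X := (a * Y + B * Y') * (a * Z + B * Z') with hX
  have hterm : ∀ s ∈ antidiagonal B, (qPoch q q s.1)⁻¹ *
      q ^ (Z' * s.1 * (Y' * s.1 + 2 * (a * Y + s.2 * Y'))) * pairTerm q Y Z Y' Z' a s.2 =
      q ^ (X + B * a) / qPoch q q a *
      ((-1) ^ s.2 * q ^ s.2.choose 2 * (q⁻¹ ^ a) ^ s.2 / (qPoch q q s.2 * qPoch q q s.1) -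
      (1 - q ^ a) * ((-1) ^ s.2 * q ^ s.2.choose 2 * (q⁻¹ ^ a * q) ^ s.2 /
        (qPoch q q s.2 * qPoch q q s.1))) := by
    rintro ⟨c, b⟩ hs
    obtain rfl : c + b = B := HasAntidiagonal.mem_antidiagonal.mp hs
    simp only
    have hexp : Z' * c * (Y' * c + 2 * (a * Y + b * Y')) + (a * Y + b * Y') * (a * Z + b * Z') =
        X + c * a := by
      have h : (Y * Z' : ℤ) = Z * Y' + 1 := by exact_mod_cast hdet
      rw [hX]
      zify
      linear_combination (a * c : ℤ) * h
    have h2 := qPoch_self_ne_zero hq a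
    have h3 := qPoch_self_ne_zero hq b
    have h4 := qPoch_self_ne_zero hq c
    have hba : (q⁻¹ ^ a) ^ b = (q ^ (b * a))⁻¹ := by
      rw [inv_pow, inv_pow, ← pow_mul, mul_comm]
    have h5 : q ^ (b * a) ≠ 0 := pow_ne_zero _ hq0
    have h6 : q ^ (Z' * c * (Y' * c + 2 * (a * Y + b * Y'))) *
        q ^ ((a * Y + b * Y') * (a * Z + b * Z')) = q ^ X * q ^ (c * a) := by
      rw [← pow_add, ← pow_add, hexp]
    have h7 : (qPoch q q c)⁻¹ * q ^ (Z' * c * (Y' * c + 2 * (a * Y + b * Y'))) *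
        pairTerm q Y Z Y' Z' a b = (qPoch q q c)⁻¹ * (q ^ X * q ^ (c * a)) *
        ((-1) ^ b * q ^ b.choose 2 * (1 - q ^ b + q ^ a * q ^ b) /
          (qPoch q q a * qPoch q q b)) := by
      rw [← h6, pairTerm, pow_add q (b.choose 2), pow_add q a]
      ring
    rw [h7, mul_pow, hba, add_mul, pow_add, pow_add]
    field_simp
    ring
  rw [sum_congr rfl hterm, ← mul_sum, sum_sub_distrib, ← mul_sum,
    ← Finset.Nat.sum_antidiagonal_swap, ← Finset.Nat.sum_antidiagonal_swap (n := B)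
      (f := fun s => (-1) ^ s.2 * q ^ s.2.choose 2 * (q⁻¹ ^ a * q) ^ s.2 /
        (qPoch q q s.2 * qPoch q q s.1))]
  simp only [Prod.fst_swap, Prod.snd_swap]
  rw [sum_antidiagonal_qPoch hq, sum_antidiagonal_qPoch hq, mul_div_assoc', one_sub_mul_qPoch hq0]
  split_ifs with hBa
  · obtain ⟨d, rfl⟩ := Nat.exists_eq_add_of_le hBa
    rw [Nat.add_sub_cancel_left]
    have h1 := qPoch_inv_pow hq0 B d
    have hX' : (d * Y + B * (Y + Y')) * (d * Z + B * (Z + Z')) = X := by rw [hX]; ring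
    have h2 := qPoch_self_ne_zero hq B
    have h3 := qPoch_self_ne_zero hq d
    have h4 := qPoch_self_ne_zero hq (B + d)
    have h5 : q ^ ((B + d) * B) ≠ 0 := pow_ne_zero _ hq0
    have h6 : qPoch (q⁻¹ ^ (B + d)) q B =
        (-1) ^ B * q ^ B.choose 2 * qPoch q q (B + d) / (qPoch q q d * q ^ ((B + d) * B)) := by
      rw [eq_div_iff (mul_ne_zero h3 h5), ← h1]; ring
    rw [pairTerm, hX', h6, pow_add q X, mul_comm B (B + d), pow_add q (B.choose 2), add_comm d B]
    field_simp
    ring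
  · rw [qPoch_inv_pow_eq_zero hq0 (not_le.mp hBa)]
    simp

theorem pairSum_one_zero_one_one {q : ℂ} (hq : ‖q‖ < 1) (l : ℕ) :
    pairSum q 1 0 1 1 l = if l = 0 then 1 else 0 := by
  have e : pairs 1 1 l = antidiagonal l := by
    ext x
    rw [mem_pairs one_pos one_pos, HasAntidiagonal.mem_antidiagonal, mul_one, mul_one]
  rw [pairSum, e, ← Finset.Nat.sum_antidiagonal_swap]
  have hterm : ∀ s ∈ antidiagonal l, pairTerm q 1 0 1 1 s.swap.1 s.swap.2 =
      (1 + q ^ l) * ((-1) ^ s.1 * q ^ s.1.choose 2 * (q ^ l) ^ s.1 /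
        (qPoch q q s.1 * qPoch q q s.2)) -
      (-1) ^ s.1 * q ^ s.1.choose 2 * (q ^ l * q) ^ s.1 / (qPoch q q s.1 * qPoch q q s.2) := by
    rintro ⟨b, a⟩ hs
    obtain rfl : b + a = l := HasAntidiagonal.mem_antidiagonal.mp hs
    simp only [pairTerm, Prod.swap_prod_mk, mul_one, mul_zero, zero_add]
    rw [mul_pow, ← pow_mul, add_comm a b, pow_add q (b.choose 2), mul_comm (qPoch q q a)]
    ring
  rw [sum_congr rfl hterm, sum_sub_distrib, ← mul_sum, sum_antidiagonal_qPoch hq,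
    sum_antidiagonal_qPoch hq]
  have h := (qPoch_succ' (q ^ l) q l).symm.trans (qPoch_succ _ _ _)
  split_ifs with hl
  · subst hl; simp [qPoch_zero]
  · obtain ⟨k, rfl⟩ := Nat.exists_eq_succ_of_ne_zero hl
    have h0 := one_sub_pow_ne_zero hq k
    -- Both sides agree after multiplication by `1 - q^l`, since `(1 - q^l)(q^(l+1); q)_l = (q^l;
    -- q)_l (1 - q^(2l))`.
    have h1 : (1 + q ^ (k + 1)) * qPoch (q ^ (k + 1)) q (k + 1) = qPoch (q ^ (k + 1) * q) q (k + 1) := by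
      refine mul_left_cancel₀ h0 ?_
      rw [Nat.succ_eq_add_one] at h
      linear_combination -h
    rw [Nat.succ_eq_add_one, mul_div_assoc', h1, sub_self]

/-! ### The continued fraction and the path of vectors -/

theorem p_add_two (p₀ : ℚ) (i : ℕ) : p p₀ (i + 2) = p p₀ i - nu p₀ i * p p₀ (i + 1) := rfl

theorem p_succ_pos_and_le {p₀ : ℚ} (hp₀ : 1 ≤ p₀) {i : ℕ} (hi : i ≤ alpha p₀) :
    0 < p p₀ (i + 1) ∧ p p₀ (i + 1) ≤ p p₀ i := by
  induction i with
  | zero => exact ⟨by simp [p], by simpa [p] using hp₀⟩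
  | succ i ih =>
    obtain ⟨h1, h2⟩ := ih (by omega)
    have hne : p p₀ (i + 2) ≠ 0 := fun h => Nat.notMem_of_lt_sInf (show i < alpha p₀ by omega) h
    have hle : (nu p₀ i : ℚ) ≤ p p₀ i / p p₀ (i + 1) :=
      Nat.floor_le (div_nonneg (h1.le.trans h2) h1.le)
    have hlt : p p₀ i / p p₀ (i + 1) < nu p₀ i + 1 := Nat.lt_floor_add_one _
    rw [le_div_iff₀ h1] at hle
    rw [div_lt_iff₀ h1] at hlt
    have h3 := p_add_two p₀ i
    have h4 : 0 ≤ p p₀ (i + 2) := by linarith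
    exact ⟨lt_of_le_of_ne h4 hne.symm, by change p p₀ (i + 2) ≤ _; linarith⟩

theorem nu_pos {p₀ : ℚ} (hp₀ : 1 ≤ p₀) {i : ℕ} (hi : i ≤ alpha p₀) : 0 < nu p₀ i := by
  obtain ⟨h1, h2⟩ := p_succ_pos_and_le hp₀ hi
  exact Nat.floor_pos.mpr ((one_le_div h1).mpr h2)

theorem p_alpha_add_two {p₀ : ℚ} (hp₀ : 1 ≤ p₀) : p p₀ (alpha p₀ + 2) = 0 :=
  Nat.sInf_mem (exists_p_eq_zero p₀ hp₀)

theorem m_mono (p₀ : ℚ) : Monotone (m p₀) :=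
  monotone_nat_of_le_succ fun _ => Nat.le_add_right _ _

theorem r_eq {p₀ : ℚ} {i j : ℕ} (hi : i ≤ alpha p₀) (h1 : m p₀ i ≤ j) (h2 : j < m p₀ (i + 1)) :
    r p₀ j = i := by
  refine (Nat.findGreatest_eq_iff).mpr ⟨by omega, fun _ => h1, fun k hk _ h => ?_⟩
  have := m_mono p₀ (show i + 1 ≤ k by omega)
  omega

theorem r_size (p₀ : ℚ) : r p₀ (size p₀) = alpha p₀ + 1 :=
  (Nat.findGreatest_eq_iff).mpr ⟨le_rfl, fun _ => le_rfl, fun k hk hk' => by omega⟩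

theorem r_spec {p₀ : ℚ} {j : ℕ} (hj : j < size p₀) :
    r p₀ j ≤ alpha p₀ ∧ m p₀ (r p₀ j) ≤ j ∧ j < m p₀ (r p₀ j + 1) := by
  have h1 : m p₀ (r p₀ j) ≤ j :=
    Nat.findGreatest_spec (P := fun i => m p₀ i ≤ j) (Nat.zero_le _) (Nat.zero_le j)
  have h2 : r p₀ j ≤ alpha p₀ + 1 := Nat.findGreatest_le _
  have h3 : r p₀ j ≤ alpha p₀ := by
    by_contra h
    have h4 : r p₀ j = alpha p₀ + 1 := by omega
    rw [h4] at h1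
    exact absurd hj (not_lt.mpr h1)
  refine ⟨h3, h1, ?_⟩
  by_contra h
  exact Nat.findGreatest_is_greatest (P := fun i => m p₀ i ≤ j) (Nat.lt_succ_self _)
    (show r p₀ j + 1 ≤ alpha p₀ + 1 by omega) (not_lt.mp h)

theorem r_zero {p₀ : ℚ} (hp₀ : 1 ≤ p₀) : r p₀ 0 = 0 :=
  r_eq (Nat.zero_le _) le_rfl (by simpa [m] using nu_pos hp₀ (Nat.zero_le _))

/-- `zShift p₀ i` is `z_{i-2}`, with `z_{-2} = 1` and `z_{-1} = 0`. -/
def zShift (p₀ : ℚ) : ℕ → ℕ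
  | 0 => 1
  | (i + 1) => zPred p₀ i

/-- The recurrence common to the numerators `y_{i-1}` and the denominators `z_{i-2}`. -/
def IsContinuant (p₀ : ℚ) (X : ℕ → ℕ) : Prop := ∀ i, X (i + 2) = X i + nu p₀ i * X (i + 1)

theorem isContinuant_yPred (p₀ : ℚ) : IsContinuant p₀ (yPred p₀) := by
  rintro (_ | i)
  · simp [yPred, y]
  · rfl

theorem isContinuant_zShift (p₀ : ℚ) : IsContinuant p₀ (zShift p₀) := by
  rintro (_ | _ | i)
  · simp [zShift, zPred, z]
  · simp [zShift, zPred, z]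
  · rfl

theorem det_continuants (p₀ : ℚ) (i : ℕ) :
    (yPred p₀ i * zShift p₀ (i + 1) - yPred p₀ (i + 1) * zShift p₀ i : ℤ) = (-1) ^ (i + 1) := by
  induction i with
  | zero => simp [yPred, zShift, zPred, y]
  | succ i ih =>
    rw [isContinuant_yPred p₀ i, isContinuant_zShift p₀ i, pow_succ, ← ih]
    push_cast
    ring

theorem p_continuants (p₀ : ℚ) (i : ℕ) :
    yPred p₀ (i + 1) * p p₀ i + yPred p₀ i * p p₀ (i + 1) = p₀ ∧
      zShift p₀ (i + 1) * p p₀ i + zShift p₀ i * p p₀ (i + 1) = 1 := by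
  induction i with
  | zero => simp [yPred, zShift, zPred, y, p]
  | succ i ih =>
    obtain ⟨h1, h2⟩ := ih
    rw [isContinuant_yPred p₀ i, isContinuant_zShift p₀ i, p_add_two]
    push_cast
    constructor
    · linear_combination h1
    · linear_combination h2

/-- The two invariants of the Euclidean algorithm at its last step, where `p_{α+2} = 0`, say `p₀ =
y_{α+1} / z_α`. -/
theorem mul_zShift {p₀ : ℚ} (hp₀ : 1 ≤ p₀) :
    p₀ * zShift p₀ (alpha p₀ + 2) = yPred p₀ (alpha p₀ + 2) := by
  obtain ⟨h1, h2⟩ := p_continuants p₀ (alpha p₀ + 1)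
  rw [p_alpha_add_two hp₀] at h1 h2
  linear_combination (-zShift p₀ (alpha p₀ + 2) : ℚ) * h1 + (yPred p₀ (alpha p₀ + 2) : ℚ) * h2

/-- The piecewise linear interpolation of a sequence of continuants. -/
noncomputable def interp (p₀ : ℚ) (X : ℕ → ℕ) (j : ℕ) : ℕ :=
  X (r p₀ j) + (j - m p₀ (r p₀ j)) * X (r p₀ j + 1)

theorem interp_yPred (p₀ : ℚ) (j : ℕ) : interp p₀ (yPred p₀) j = n p₀ j := rfl

theorem interp_zero {p₀ : ℚ} (hp₀ : 1 ≤ p₀) (X : ℕ → ℕ) : interp p₀ X 0 = X 0 := by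
  simp [interp, r_zero hp₀]

theorem interp_size (p₀ : ℚ) (X : ℕ → ℕ) : interp p₀ X (size p₀) = X (alpha p₀ + 1) := by
  simp [interp, r_size]

/-- The Farey path: inside a block each step adds the fixed vector `X (r + 1)`. At the end of a
block the value becomes `X (r + 1)` itself, while one further step in the old direction would have
reached `X (r + 2)`, the direction of the next block. -/
theorem interp_succ {p₀ : ℚ} (hp₀ : 1 ≤ p₀) {j : ℕ} (hj : j < size p₀) :
    (j + 1 < m p₀ (r p₀ j + 1) ∧ r p₀ (j + 1) = r p₀ j ∧ ∀ X, IsContinuant p₀ X →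
      interp p₀ X (j + 1) = interp p₀ X j + X (r p₀ j + 1)) ∨
    (j + 1 = m p₀ (r p₀ j + 1) ∧ r p₀ (j + 1) = r p₀ j + 1 ∧ ∀ X, IsContinuant p₀ X →
      interp p₀ X (j + 1) = X (r p₀ j + 1) ∧
        interp p₀ X j + X (r p₀ j + 1) = X (r p₀ j + 2)) := by
  obtain ⟨h1, h2, h3⟩ := r_spec hj
  rcases Nat.lt_or_ge (j + 1) (m p₀ (r p₀ j + 1)) with h | h
  · have hr : r p₀ (j + 1) = r p₀ j := r_eq h1 (by omega) h
    refine Or.inl ⟨h, hr, fun X _ => ?_⟩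
    rw [interp, interp, hr, show j + 1 - m p₀ (r p₀ j) = j - m p₀ (r p₀ j) + 1 by omega]
    ring
  · have he : j + 1 = m p₀ (r p₀ j + 1) := by omega
    have hr : r p₀ (j + 1) = r p₀ j + 1 := by
      rcases h1.lt_or_eq with h4 | h4
      · refine r_eq h4 he.ge ?_
        have := nu_pos hp₀ (show r p₀ j + 1 ≤ alpha p₀ from h4)
        rw [he]
        change _ < m p₀ (r p₀ j + 1) + nu p₀ (r p₀ j + 1)
        omega
      · rw [he, h4, r_size]
    refine Or.inr ⟨he, hr, fun X hX => ⟨?_, ?_⟩⟩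
    · rw [interp, hr, he]; simp
    · have hm : m p₀ (r p₀ j + 1) = m p₀ (r p₀ j) + nu p₀ (r p₀ j) := rfl
      rw [hX, interp, show nu p₀ (r p₀ j) = j - m p₀ (r p₀ j) + 1 by omega]
      ring

theorem det_interp (p₀ : ℚ) (j : ℕ) :
    (n p₀ j * zShift p₀ (r p₀ j + 1) - yPred p₀ (r p₀ j + 1) * interp p₀ (zShift p₀) j : ℤ) =
      (-1) ^ (r p₀ j + 1) := by
  rw [← det_continuants, ← interp_yPred, interp, interp]
  push_cast
  ring

theorem det_interp_succ {p₀ : ℚ} (hp₀ : 1 ≤ p₀) {j : ℕ} (hj : j < size p₀) :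
    (n p₀ j * interp p₀ (zShift p₀) (j + 1) - n p₀ (j + 1) * interp p₀ (zShift p₀) j : ℤ) =
      (-1) ^ (r p₀ j + 1) := by
  rw [← det_interp, ← interp_yPred p₀ (j + 1)]
  rcases interp_succ hp₀ hj with ⟨-, -, h⟩ | ⟨-, -, h⟩
  · rw [h _ (isContinuant_zShift p₀), h _ (isContinuant_yPred p₀), interp_yPred]
    push_cast
    ring
  · rw [(h _ (isContinuant_zShift p₀)).1, (h _ (isContinuant_yPred p₀)).1]

/-! ### The inverse matrix -/

theorem c_succ_self (p₀ : ℚ) (j : ℕ) : c p₀ (j + 1) j = (-1) ^ (r p₀ (j + 1) + 1) := by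
  rw [c, if_neg (by omega), if_neg (by omega), if_pos rfl]

theorem c_self_succ (p₀ : ℚ) (j : ℕ) : c p₀ j (j + 1) = (-1) ^ (r p₀ (j + 1) + 1) := by
  simp [c]

/-- Interior rows of `C` encode the second-order recurrence: zero second difference inside a block,
change of slope at its end. Row 1 formally refers to index 0, which is harmless only for sequences
vanishing there, such as `n`. -/
theorem c_interp {p₀ : ℚ} (hp₀ : 1 ≤ p₀) {X : ℕ → ℕ} (hX : IsContinuant p₀ X) {j : ℕ}
    (hj : j + 1 < size p₀) :
    c p₀ (j + 1) j * ((-1) ^ r p₀ j * interp p₀ X j) +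
      c p₀ (j + 1) (j + 1) * ((-1) ^ r p₀ (j + 1) * interp p₀ X (j + 1)) +
      c p₀ (j + 1) (j + 2) * ((-1) ^ r p₀ (j + 2) * interp p₀ X (j + 2)) = 0 := by
  have hc : c p₀ (j + 1) (j + 1) = if j + 1 + 1 = m p₀ (r p₀ (j + 1) + 1)
      then (-1) ^ r p₀ (j + 1) else 2 * (-1) ^ r p₀ (j + 1) := by
    simp [c, cDiag, hj.ne]
  rw [c_succ_self, c_self_succ, hc]
  rcases interp_succ hp₀ (show j < size p₀ by omega) with ⟨h1, h2, h3⟩ | ⟨h1, h2, h3⟩ <;>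
  rcases interp_succ hp₀ hj with ⟨g1, g2, g3⟩ | ⟨g1, g2, g3⟩
  · rw [if_neg g1.ne, g2, g3 X hX, h2, h3 X hX]
    push_cast
    ring
  · rw [if_pos g1, g2, (g3 X hX).1, h2, h3 X hX]
    push_cast
    ring
  · rw [if_neg g1.ne, g2, g3 X hX, h2, ← (h3 X hX).2, (h3 X hX).1]
    push_cast
    ring
  · rw [if_pos g1, g2, (g3 X hX).1, h2, ← (h3 X hX).2, (h3 X hX).1]
    push_cast
    ring

theorem c_interp_size {p₀ : ℚ} (hp₀ : 1 ≤ p₀) {X : ℕ → ℕ} (hX : IsContinuant p₀ X) {j : ℕ}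
    (hj : j + 1 = size p₀) :
    c p₀ (j + 1) j * ((-1) ^ r p₀ j * interp p₀ X j) +
      c p₀ (j + 1) (j + 1) * ((-1) ^ r p₀ (j + 1) * interp p₀ X (j + 1)) =
        X (alpha p₀ + 2) := by
  have hc : c p₀ (j + 1) (j + 1) = (-1) ^ (alpha p₀ + 1) := by simp [c, cDiag, hj]
  have hr : r p₀ (j + 1) = alpha p₀ + 1 := by rw [hj, r_size]
  have hk : ((-1 : ℚ) ^ alpha p₀) ^ 2 = 1 := by rw [← pow_mul, mul_comm, pow_mul]; simp
  rw [c_succ_self, hc]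
  rcases interp_succ hp₀ (show j < size p₀ by omega) with ⟨h1, h2, h3⟩ | ⟨h1, h2, h3⟩
  · have := (r_spec (show j < size p₀ by omega)).1
    omega
  · have h4 : r p₀ j = alpha p₀ := by omega
    obtain ⟨h5, h6⟩ := h3 X hX
    rw [hr, h5, h4, ← h4, ← h6, h4]
    push_cast
    linear_combination ((interp p₀ X j : ℚ) + X (alpha p₀ + 1)) * hk

theorem sum_c_mul (p₀ : ℚ) (g : ℕ → ℚ) (hg : g 0 = 0) {j : ℕ} (hj : j < size p₀) :
    ∑ k : Fin (size p₀), c p₀ (j + 1) ((k : ℕ) + 1) * g ((k : ℕ) + 1) =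
      c p₀ (j + 1) j * g j + c p₀ (j + 1) (j + 1) * g (j + 1) +
        if j + 1 < size p₀ then c p₀ (j + 1) (j + 2) * g (j + 2) else 0 := by
  -- Since `g 0 = 0`, a term with index 0 may be added, which makes the first row look like the
  -- others.
  rw [Fin.sum_univ_eq_sum_range (fun k => c p₀ (j + 1) (k + 1) * g (k + 1))]
  have h := sum_range_succ' (fun k => c p₀ (j + 1) k * g k) (size p₀)
  simp only [hg, mul_zero, add_zero] at h
  rw [← h]
  have hterm : ∀ k ∈ range (size p₀ + 1), c p₀ (j + 1) k * g k =
      (if k = j then c p₀ (j + 1) j * g j else 0) +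
      (if k = j + 1 then c p₀ (j + 1) (j + 1) * g (j + 1) else 0) +
      (if k = j + 2 then c p₀ (j + 1) (j + 2) * g (j + 2) else 0) := by
    intro k _
    by_cases h1 : k = j
    · subst h1; simp
    by_cases h2 : k = j + 1
    · subst h2; simp
    by_cases h3 : k = j + 2
    · subst h3; simp
    have h4 : c p₀ (j + 1) k = 0 := by
      rw [c, if_neg (by omega), if_neg (by omega), if_neg (by omega)]
    simp [h1, h2, h3, h4]
  rw [sum_congr rfl hterm, sum_add_distrib, sum_add_distrib, sum_ite_eq', sum_ite_eq', sum_ite_eq',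
    if_pos (by rw [mem_range]; omega), if_pos (by rw [mem_range]; omega)]
  simp [Nat.succ_le_iff]

/-- `d_j - n_j / p₀`, where `d_j` interpolates the denominators `z_{i-2}`. -/
noncomputable def defect (p₀ : ℚ) (j : ℕ) : ℚ := interp p₀ (zShift p₀) j - n p₀ j / p₀

/-- Green function of the recurrence: `n` satisfies the boundary condition at 0, `defect` the one at
the last row because `p₀ z_α = y_{α+1}`, and their discrete Wronskian is `±1` by `det_interp_succ`.
-/
theorem theta_apply {p₀ : ℚ} (hp₀ : 1 ≤ p₀) (i j : Fin (size p₀)) :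
    theta p₀ i j = eps p₀ i * eps p₀ j *
      (n p₀ (min (i : ℕ) j + 1) * defect p₀ (max (i : ℕ) j + 1)) := by
  have hp0 : p₀ ≠ 0 := by positivity
  have hs : ∀ k : ℕ, ((-1 : ℚ) ^ k) * (-1) ^ k = 1 := fun k => by rw [← mul_pow]; simp
  suffices h : theta p₀ = Matrix.of fun i j : Fin (size p₀) =>
      (-1 : ℚ) ^ r p₀ ((i : ℕ) + 1) * (-1) ^ r p₀ ((j : ℕ) + 1) *
      (n p₀ (min ((i : ℕ) + 1) (j + 1)) * defect p₀ (max ((i : ℕ) + 1) (j + 1))) by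
    rw [h]
    simp [eps]
  refine Matrix.inv_eq_right_inv ?_
  ext ⟨i, hi⟩ ⟨j, hj⟩
  have hn0 : n p₀ 0 = 0 := by rw [← interp_yPred, interp_zero hp₀]; rfl
  have hsum := sum_c_mul p₀ (fun k => (-1 : ℚ) ^ r p₀ k * (-1) ^ r p₀ (j + 1) *
      (n p₀ (min k (j + 1)) * defect p₀ (max k (j + 1)))) (by simp [hn0]) hi
  rw [Matrix.mul_apply]
  simp only [thetaInv, Matrix.of_apply]
  rw [hsum, Matrix.one_apply]
  simp only [Fin.mk.injEq]
  have recN := fun h => c_interp hp₀ (isContinuant_yPred p₀) (j := i) h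
  have recZ := fun h => c_interp hp₀ (isContinuant_zShift p₀) (j := i) h
  have lastN := fun h => c_interp_size hp₀ (isContinuant_yPred p₀) (j := i) h
  have lastZ := fun h => c_interp_size hp₀ (isContinuant_zShift p₀) (j := i) h
  simp only [interp_yPred] at recN lastN
  have hend := mul_zShift hp₀
  rcases lt_trichotomy i j with hij | rfl | hij
  · rw [if_neg hij.ne, if_pos (by omega), min_eq_left (by omega), min_eq_left (by omega),
      min_eq_left (by omega), max_eq_right (by omega), max_eq_right (by omega),
      max_eq_right (by omega)]
    linear_combination ((-1) ^ r p₀ (j + 1) * defect p₀ (j + 1)) * recN (by omega)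
  · rw [if_pos rfl, min_eq_left (by omega), max_eq_right (by omega), min_self, max_self]
    split_ifs with h
    · rw [min_eq_right (by omega), max_eq_left (by omega)]
      have hdet := det_interp_succ hp₀ (j := i + 1) h
      have hdet' : (n p₀ (i + 1) * interp p₀ (zShift p₀) (i + 2) -
          n p₀ (i + 2) * interp p₀ (zShift p₀) (i + 1) : ℚ) = (-1) ^ (r p₀ (i + 1) + 1) := by
        exact_mod_cast hdet
      have hN := recN h
      rw [c_self_succ p₀ (i + 1)] at hN ⊢
      have h1 := hs (r p₀ (i + 1))
      have h2 := hs (r p₀ (i + 2))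
      have hw : (n p₀ (i + 1) * defect p₀ (i + 2) - n p₀ (i + 2) * defect p₀ (i + 1) : ℚ) =
          (-1) ^ (r p₀ (i + 1) + 1) := by
        rw [← hdet', defect, defect]
        ring
      rw [pow_succ] at hw hN ⊢
      linear_combination ((-1) ^ r p₀ (i + 1) * defect p₀ (i + 1)) * hN -
        (-1) ^ r p₀ (i + 1) * (-1) ^ r p₀ (i + 2) * (-1) ^ r p₀ (i + 2) * hw +
        ((-1) ^ r p₀ (i + 1) * (-1) ^ r p₀ (i + 1)) * h2 + h1
    · have hN := lastN (by omega)
      have he : i + 1 = size p₀ := by omega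
      have hr : r p₀ (i + 1) = alpha p₀ + 1 := by rw [he, r_size]
      have hdet := det_continuants p₀ (alpha p₀ + 1)
      have hdet' : (yPred p₀ (alpha p₀ + 1) * zShift p₀ (alpha p₀ + 2) -
          yPred p₀ (alpha p₀ + 2) * zShift p₀ (alpha p₀ + 1) : ℚ) = (-1) ^ (alpha p₀ + 2) := by
        exact_mod_cast hdet
      have hd : p₀ * defect p₀ (i + 1) =
          p₀ * zShift p₀ (alpha p₀ + 1) - yPred p₀ (alpha p₀ + 1) := by
        rw [defect, he, interp_size, ← interp_yPred, interp_size]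
        field_simp
      have hd2 : defect p₀ (i + 1) * yPred p₀ (alpha p₀ + 2) = (-1) ^ (alpha p₀ + 1) := by
        rw [← hend]
        rw [← hend] at hdet'
        rw [pow_succ] at hdet'
        linear_combination zShift p₀ (alpha p₀ + 2) * hd - hdet'
      have h1 := hs (alpha p₀ + 1)
      have h3 := hs (r p₀ (i + 1))
      rw [hr] at hN ⊢
      linear_combination ((-1) ^ (alpha p₀ + 1) * defect p₀ (i + 1)) * hN +
        (-1) ^ (alpha p₀ + 1) * hd2 + h1
  · rw [if_neg hij.ne', min_eq_right (by omega), max_eq_left (by omega), min_eq_right (by omega),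
      max_eq_left (by omega), min_eq_right (by omega), max_eq_left (by omega)]
    simp only [defect]
    split_ifs with h
    · linear_combination ((-1) ^ r p₀ (j + 1) * (n p₀ (j + 1) : ℚ)) * (recZ h - recN h / p₀)
    · have hz : (zShift p₀ (alpha p₀ + 2) : ℚ) - yPred p₀ (alpha p₀ + 2) / p₀ = 0 := by
        rw [← hend]; field_simp; ring
      linear_combination ((-1) ^ r p₀ (j + 1) * (n p₀ (j + 1) : ℚ)) *
        (lastZ (by omega) - lastN (by omega) / p₀ + hz)

theorem quadratic_form {p₀ : ℚ} (hp₀ : 1 ≤ p₀) (lam : Fin (size p₀) → ℕ) :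
    (∑ k : Fin (size p₀), n p₀ ((k : ℕ) + 1) * lam k : ℚ) ^ 2 / p₀ +
      1 / 2 * (tilde p₀ lam ⬝ᵥ (B p₀).mulVec (tilde p₀ lam)) =
      ∑ i : Fin (size p₀), ∑ j : Fin (size p₀), (lam i * lam j *
        (n p₀ (min (i : ℕ) j + 1) * interp p₀ (zShift p₀) (max (i : ℕ) j + 1)) : ℚ) := by
  have he : ∀ i, (eps p₀ i : ℚ) * eps p₀ i = 1 := fun i => by
    rw [eps]; push_cast; rw [← mul_pow]; simp
  simp only [B, dotProduct, Matrix.mulVec, Matrix.smul_apply, smul_eq_mul, tilde,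
    theta_apply hp₀, mul_sum, sq, sum_mul, sum_div]
  rw [← sum_add_distrib]
  refine sum_congr rfl fun i _ => ?_
  rw [← sum_add_distrib]
  refine sum_congr rfl fun j _ => ?_
  -- With this symmetry the `1 / p₀` part of `Θ` is a product of linear forms and cancels the square
  -- of `∑ n_k λ_k`.
  have hnn : (n p₀ ((i : ℕ) + 1) : ℚ) * n p₀ ((j : ℕ) + 1) =
      n p₀ (min (i : ℕ) j + 1) * n p₀ (max (i : ℕ) j + 1) := by
    rcases le_total (i : ℕ) j with h | h
    · rw [min_eq_left h, max_eq_right h]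
    · rw [min_eq_right h, max_eq_left h, mul_comm]
  rw [defect]
  linear_combination (lam i * lam j / p₀ : ℚ) * hnn +
    (lam i * lam j * (n p₀ (min (i : ℕ) j + 1) * (interp p₀ (zShift p₀) (max (i : ℕ) j + 1) -
      n p₀ (max (i : ℕ) j + 1) / p₀)) : ℚ) * ((eps p₀ j * eps p₀ j) * he i + he j)

/-! ### The sums `V_l` as two-dimensional sums -/

/-- The summation weight `1 / (q^ε; q^ε)_c` with `ε = (-1)^k`. -/
noncomputable def weight (q : ℂ) (k c : ℕ) : ℂ :=
  if Even k then (qPoch q q c)⁻¹ else (qPoch q⁻¹ q⁻¹ c)⁻¹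

/-- The sum over the first `j` summation variables only. -/
noncomputable def partialSum (p₀ : ℚ) (q : ℂ) : ℕ → ℕ → ℂ
  | 0 => fun l => if l = 0 then 1 else 0
  | (j + 1) => adjoin q (weight q (r p₀ (j + 1))) (n p₀ (j + 1)) (interp p₀ (zShift p₀) (j + 1))
      (partialSum p₀ q j)

theorem partialSum_eq {p₀ : ℚ} (hp₀ : 1 ≤ p₀) {q : ℂ} (hq : ‖q‖ < 1) (hq0 : q ≠ 0) {j : ℕ}
    (hj : j ≤ size p₀) :
    partialSum p₀ q j = if Even (r p₀ j) then
      pairSum q (yPred p₀ (r p₀ j + 1)) (zShift p₀ (r p₀ j + 1))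
        (n p₀ j + yPred p₀ (r p₀ j + 1)) (interp p₀ (zShift p₀) j + zShift p₀ (r p₀ j + 1))
    else
      pairSum q (n p₀ j + yPred p₀ (r p₀ j + 1)) (interp p₀ (zShift p₀) j + zShift p₀ (r p₀ j + 1))
        (yPred p₀ (r p₀ j + 1)) (zShift p₀ (r p₀ j + 1)) := by
  induction j with
  | zero =>
    funext l
    rw [r_zero hp₀, interp_zero hp₀, ← interp_yPred, interp_zero hp₀, if_pos Even.zero]
    simp only [partialSum, yPred, zShift, zPred, y, zero_add, add_zero]
    rw [pairSum_one_zero_one_one hq]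
  | succ j ih =>
    have hj' : j < size p₀ := hj
    have hpos : 0 < yPred p₀ (r p₀ j + 1) := y_pos p₀ hp₀ _
    have hdet := det_interp p₀ j
    funext l
    rw [partialSum, ih hj'.le]
    have hpos' : 0 < n p₀ j + yPred p₀ (r p₀ j + 1) := Nat.add_pos_right _ hpos
    rcases Nat.even_or_odd (r p₀ j) with hr | hr
    · rw [if_pos hr]
      rw [pow_succ, hr.neg_one_pow] at hdet
      have hd : yPred p₀ (r p₀ j + 1) * (interp p₀ (zShift p₀) j + zShift p₀ (r p₀ j + 1)) =
          zShift p₀ (r p₀ j + 1) * (n p₀ j + yPred p₀ (r p₀ j + 1)) + 1 := by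
        zify
        linear_combination -hdet
      rcases interp_succ hp₀ hj' with ⟨-, h2, h3⟩ | ⟨-, h2, h3⟩
      · have hw : weight q (r p₀ j) = fun c => (qPoch q q c)⁻¹ := by
          funext c; rw [weight, if_pos hr]
        rw [h2, if_pos hr, hw, ← interp_yPred p₀ (j + 1), h3 _ (isContinuant_yPred p₀),
          h3 _ (isContinuant_zShift p₀), interp_yPred, adjoin_pairSum_right hq hq0 hpos hpos' hd]
        congr 1 <;> ring
      · have hr' : ¬ Even (r p₀ j + 1) := by rw [Nat.even_add_one, not_not]; exact hr
        have hw : weight q (r p₀ j + 1) = fun c => (qPoch q⁻¹ q⁻¹ c)⁻¹ := by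
          funext c; rw [weight, if_neg hr']
        obtain ⟨e1, e2⟩ := h3 _ (isContinuant_yPred p₀)
        obtain ⟨e3, e4⟩ := h3 _ (isContinuant_zShift p₀)
        rw [h2, if_neg hr', hw, ← interp_yPred p₀ (j + 1), e1, e3, ← e2, ← e4, interp_yPred,
          adjoin_pairSum_left hq hq0 hpos hpos' hd]
    · have hr1 : ¬ Even (r p₀ j) := Nat.not_even_iff_odd.mpr hr
      rw [if_neg hr1]
      rw [pow_succ, hr.neg_one_pow] at hdet
      have hd : (n p₀ j + yPred p₀ (r p₀ j + 1)) * zShift p₀ (r p₀ j + 1) =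
          (interp p₀ (zShift p₀) j + zShift p₀ (r p₀ j + 1)) * yPred p₀ (r p₀ j + 1) + 1 := by
        zify
        linear_combination hdet
      rcases interp_succ hp₀ hj' with ⟨-, h2, h3⟩ | ⟨-, h2, h3⟩
      · have hw : weight q (r p₀ j) = fun c => (qPoch q⁻¹ q⁻¹ c)⁻¹ := by
          funext c; rw [weight, if_neg hr1]
        rw [h2, if_neg hr1, hw, ← interp_yPred p₀ (j + 1), h3 _ (isContinuant_yPred p₀),
          h3 _ (isContinuant_zShift p₀), interp_yPred, adjoin_pairSum_left hq hq0 hpos' hpos hd]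
      · have hr' : Even (r p₀ j + 1) := hr.add_one
        have hw : weight q (r p₀ j + 1) = fun c => (qPoch q q c)⁻¹ := by
          funext c; rw [weight, if_pos hr']
        obtain ⟨e1, e2⟩ := h3 _ (isContinuant_yPred p₀)
        obtain ⟨e3, e4⟩ := h3 _ (isContinuant_zShift p₀)
        rw [h2, if_pos hr', hw, ← interp_yPred p₀ (j + 1), e1, e3, ← e2, ← e4, interp_yPred,
          adjoin_pairSum_right hq hq0 hpos' hpos hd]
        congr 1 <;> ring

/-- The sequences of `j` non-negative integers with `∑ n_k λ_k = l`. -/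
noncomputable def partialConfigs (p₀ : ℚ) (j l : ℕ) : Finset (Fin j → ℕ) :=
  (Fintype.piFinset fun _ => range (l + 1)).filter
    fun lam => ∑ k : Fin j, n p₀ ((k : ℕ) + 1) * lam k = l

theorem mem_partialConfigs {p₀ : ℚ} (hp₀ : 1 ≤ p₀) (j l : ℕ) (lam : Fin j → ℕ) :
    lam ∈ partialConfigs p₀ j l ↔ ∑ k : Fin j, n p₀ ((k : ℕ) + 1) * lam k = l := by
  simp only [partialConfigs, mem_filter, Fintype.mem_piFinset, mem_range, and_iff_right_iff_imp]
  rintro rfl k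
  refine Nat.lt_succ_of_le (le_trans ?_ (single_le_sum
    (f := fun k : Fin j => n p₀ ((k : ℕ) + 1) * lam k) (fun _ _ => Nat.zero_le _) (mem_univ k)))
  exact Nat.le_mul_of_pos_left _ (n_pos p₀ hp₀ _ (Nat.succ_pos _))

/-- The exponent of `q` attached to a sequence. -/
noncomputable def exponent (p₀ : ℚ) (j : ℕ) (lam : Fin j → ℕ) : ℕ :=
  ∑ i : Fin j, ∑ k : Fin j, lam i * lam k *
    (n p₀ (min (i : ℕ) k + 1) * interp p₀ (zShift p₀) (max (i : ℕ) k + 1))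

/-- The last index is the maximum in every cross term, so the old variables interact with the new
one only through `∑ n_k λ_k`. This is why `adjoin` needs no other information. -/
theorem exponent_succ (p₀ : ℚ) (j : ℕ) (lam : Fin (j + 1) → ℕ) :
    exponent p₀ (j + 1) lam = interp p₀ (zShift p₀) (j + 1) * lam (Fin.last j) *
        (n p₀ (j + 1) * lam (Fin.last j) +
          2 * ∑ k : Fin j, n p₀ ((k : ℕ) + 1) * lam k.castSucc) +
      exponent p₀ j fun k => lam k.castSucc := by
  simp only [exponent, Fin.sum_univ_castSucc, Fin.val_castSucc, Fin.val_last, sum_add_distrib,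
    min_self, max_self]
  have h1 : ∀ i : Fin j, lam i.castSucc * lam (Fin.last j) *
      (n p₀ (min (i : ℕ) j + 1) * interp p₀ (zShift p₀) (max (i : ℕ) j + 1)) =
      interp p₀ (zShift p₀) (j + 1) * lam (Fin.last j) *
        (n p₀ ((i : ℕ) + 1) * lam i.castSucc) := fun i => by
    rw [min_eq_left i.2.le, max_eq_right i.2.le]; ring
  have h2 : ∀ i : Fin j, lam (Fin.last j) * lam i.castSucc *
      (n p₀ (min j (i : ℕ) + 1) * interp p₀ (zShift p₀) (max j (i : ℕ) + 1)) =
      interp p₀ (zShift p₀) (j + 1) * lam (Fin.last j) *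
        (n p₀ ((i : ℕ) + 1) * lam i.castSucc) := fun i => by
    rw [min_eq_right i.2.le, max_eq_left i.2.le]; ring
  simp only [h1, h2, ← mul_sum]
  ring

theorem partialSum_eq_sum {p₀ : ℚ} (hp₀ : 1 ≤ p₀) (q : ℂ) (j l : ℕ) :
    partialSum p₀ q j l = ∑ lam ∈ partialConfigs p₀ j l,
      q ^ exponent p₀ j lam * ∏ k : Fin j, weight q (r p₀ ((k : ℕ) + 1)) (lam k) := by
  induction j generalizing l with
  | zero =>
    simp only [partialSum]
    split_ifs with hl
    · subst hl
      have : partialConfigs p₀ 0 0 = {Fin.elim0} := by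
        ext lam
        rw [mem_partialConfigs hp₀, mem_singleton]
        simp [Subsingleton.elim lam Fin.elim0]
      rw [this]
      simp [exponent]
    · symm
      refine sum_eq_zero fun lam h => absurd ((mem_partialConfigs hp₀ 0 l lam).mp h) ?_
      simpa using Ne.symm hl
  | succ j ih =>
    have hn := n_pos p₀ hp₀ (j + 1) (Nat.succ_pos j)
    simp only [partialSum, adjoin, ih, mul_sum]
    rw [sum_sigma']
    refine sum_nbij' (fun x => Fin.snoc x.2 x.1.1)
      (fun lam => ⟨(lam (Fin.last j), ∑ k : Fin j, n p₀ ((k : ℕ) + 1) * lam k.castSucc),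
        fun k => lam k.castSucc⟩) ?_ ?_ ?_ ?_ ?_
    · rintro ⟨⟨c, l'⟩, lam⟩ h
      simp only [mem_sigma, mem_pairs hn one_pos, mem_partialConfigs hp₀] at h ⊢
      rw [Fin.sum_univ_castSucc]
      simp only [Fin.snoc_castSucc, Fin.snoc_last, Fin.val_castSucc, Fin.val_last]
      rw [h.2, mul_comm (n p₀ (j + 1)), ← h.1]
      ring
    · intro lam h
      simp only [mem_sigma, mem_pairs hn one_pos, mem_partialConfigs hp₀] at h ⊢
      rw [Fin.sum_univ_castSucc] at h
      refine ⟨?_, trivial⟩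
      rw [← h]
      simp only [Fin.val_castSucc, Fin.val_last]
      ring
    · rintro ⟨⟨c, l'⟩, lam⟩ h
      simp only [mem_sigma, mem_partialConfigs hp₀] at h
      simp [h.2]
    · intro lam _
      exact Fin.snoc_init_self lam
    · rintro ⟨⟨c, l'⟩, lam⟩ h
      simp only [mem_sigma, mem_partialConfigs hp₀] at h
      rw [exponent_succ, Fin.prod_univ_castSucc]
      simp only [Fin.snoc_castSucc, Fin.snoc_last, Fin.val_castSucc, Fin.val_last]
      rw [h.2, pow_add]
      ring

theorem qPow_V {p₀ : ℚ} (hp₀ : 1 ≤ p₀) (w : ℂ) (l : ℕ) :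
    qPow w ((l : ℚ) ^ 2 / p₀) * V p₀ w l = partialSum p₀ (Complex.exp w) (size p₀) l := by
  rw [partialSum_eq_sum hp₀, V, mul_sum]
  refine sum_congr rfl fun lam hlam => ?_
  have hl := (mem_configs p₀ hp₀ l lam).mp hlam
  have hprod : (∏ j : Fin (size p₀), qPoch (qPow w (eps p₀ j)) (qPow w (eps p₀ j)) (lam j))⁻¹ =
      ∏ k : Fin (size p₀), weight (Complex.exp w) (r p₀ ((k : ℕ) + 1)) (lam k) := by
    rw [← prod_inv_distrib]
    refine prod_congr rfl fun k _ => ?_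
    rw [weight, eps]
    split_ifs with h
    · simp [h.neg_one_pow, qPow]
    · simp [(Nat.not_even_iff_odd.mp h).neg_one_pow, qPow, Complex.exp_neg]
  have hq := quadratic_form hp₀ lam
  rw [mul_div_assoc', div_eq_mul_inv, hprod]
  congr 1
  rw [qPow, qPow, ← Complex.exp_add, ← mul_add, ← Rat.cast_add, ← Complex.exp_nat_mul, mul_comm w]
  congr 2
  have hl' : (∑ k : Fin (size p₀), (n p₀ ((k : ℕ) + 1) * lam k : ℚ)) = l := by exact_mod_cast hl
  rw [hl'] at hq
  rw [hq, exponent]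
  push_cast
  rfl

/-! ### Summation -/

/-- `ℕ × ℕ` is partitioned by the value of `a Y + b W`. Using it for two choices of `(Y, W)` equates
the two sides of the theorem. -/
theorem hasSum_pairs {g : ℕ → ℕ → ℂ} {S : ℂ} (h : HasSum (fun x : ℕ × ℕ => g x.1 x.2) S) {Y W : ℕ}
    (hY : 0 < Y) (hW : 0 < W) : HasSum (fun l => ∑ x ∈ pairs Y W l, g x.1 x.2) S := by
  have h1 := (Equiv.sigmaFiberEquiv fun x : ℕ × ℕ => x.1 * Y + x.2 * W).hasSum_iff.mpr h
  refine h1.sigma fun l => ?_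
  have h2 := (pairs Y W l).hasSum fun x => g x.1 x.2
  exact (Equiv.subtypeEquivRight (mem_pairs (l := l) hY hW)).symm.hasSum_iff.mpr h2

theorem summable_pairTerm {q : ℂ} (hq : ‖q‖ < 1) {Y Z Y' Z' : ℕ} (hY : 0 < Y) (hZ : 0 < Z)
    (hY' : 0 < Y') (hZ' : 0 < Z') :
    Summable fun x : ℕ × ℕ => pairTerm q Y Z Y' Z' x.1 x.2 := by
  set ρ := ‖q‖ with hρ
  have hρ0 : 0 ≤ ρ := norm_nonneg q
  have h1ρ : 0 < 1 - ρ := sub_pos.mpr hq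
  set C := (1 - ρ)⁻¹ with hC
  have hC1 : 1 ≤ C := (one_le_inv₀ h1ρ).mpr (by linarith)
  have hP : ∀ k, ‖qPoch q q k‖⁻¹ ≤ C ^ k := by
    intro k
    rw [hC, inv_pow]
    refine inv_anti₀ (pow_pos h1ρ k) ?_
    rw [qPoch, norm_prod]
    calc (1 - ρ) ^ k = ∏ _i ∈ range k, (1 - ρ) := by simp
      _ ≤ _ := prod_le_prod (fun _ _ => h1ρ.le) fun i _ => ?_
    have h2 : ‖q * q ^ i‖ ≤ ρ := by
      rw [norm_mul, norm_pow]
      exact mul_le_of_le_one_right hρ0 (pow_le_one₀ hρ0 hq.le)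
    have h3 := norm_sub_norm_le (1 : ℂ) (q * q ^ i)
    rw [norm_one] at h3
    linarith
  -- From `k = N` on, `ρ^k C ≤ 1/2`, so the quadratic exponent beats the growth `C^k` of the inverse
  -- `q`-factorials; smaller `k` are absorbed in `(2 C)^N`.
  obtain ⟨N, hN⟩ : ∃ N : ℕ, ρ ^ N < (2 * C)⁻¹ := exists_pow_lt_of_lt_one (by positivity) hq
  have hG : ∀ k : ℕ, ρ ^ (k * k) * C ^ k ≤ (2 * C) ^ N * (1 / 2) ^ k := by
    intro k
    have h2C : 1 ≤ 2 * C := by linarith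
    rcases le_total k N with h | h
    · have h2 : ρ ^ (k * k) ≤ 1 := pow_le_one₀ hρ0 hq.le
      have h3 : (2 * C) ^ k ≤ (2 * C) ^ N := pow_le_pow_right₀ h2C h
      calc ρ ^ (k * k) * C ^ k ≤ 1 * C ^ k := by gcongr
        _ = (2 * C) ^ k * (1 / 2) ^ k := by rw [← mul_pow]; ring
        _ ≤ _ := by gcongr
    · have h2 : ρ ^ k * C ≤ 1 / 2 := by
        have h3 : ρ ^ k ≤ ρ ^ N := pow_le_pow_of_le_one hρ0 hq.le h
        calc ρ ^ k * C ≤ (2 * C)⁻¹ * C := by gcongr; exact h3.trans hN.le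
          _ = 1 / 2 := by field_simp
      calc ρ ^ (k * k) * C ^ k = (ρ ^ k * C) ^ k := by rw [pow_mul, mul_pow]
        _ ≤ (1 / 2) ^ k := by gcongr
        _ ≤ _ := le_mul_of_one_le_left (by positivity) (one_le_pow₀ h2C)
  have hsum : Summable fun x : ℕ × ℕ => 3 * (2 * C) ^ N * ((1 / 2 : ℝ) ^ x.1 * (1 / 2) ^ x.2) :=
    (summable_geometric_two.mul_of_nonneg summable_geometric_two (fun _ => by positivity)
      (fun _ => by positivity)).mul_left _
  refine hsum.of_norm_bounded fun ⟨a, b⟩ => ?_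
  simp only
  have hexp : (a + b) * (a + b) ≤ b.choose 2 + (a * Y + b * Y') * (a * Z + b * Z') := by
    have h1 := Nat.le_mul_of_pos_right a hY
    have h2 := Nat.le_mul_of_pos_right b hY'
    have h3 := Nat.le_mul_of_pos_right a hZ
    have h4 := Nat.le_mul_of_pos_right b hZ'
    exact le_trans (Nat.mul_le_mul (by omega) (by omega)) (Nat.le_add_left _ _)
  have h3 : ‖1 - q ^ b + q ^ (a + b)‖ ≤ 3 := by
    have e1 : ‖q ^ b‖ ≤ 1 := by rw [norm_pow]; exact pow_le_one₀ hρ0 hq.le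
    have e2 : ‖q ^ (a + b)‖ ≤ 1 := by rw [norm_pow]; exact pow_le_one₀ hρ0 hq.le
    have e3 := norm_add_le (1 - q ^ b) (q ^ (a + b))
    have e4 := norm_sub_le (1 : ℂ) (q ^ b)
    rw [norm_one] at e4
    linarith
  calc ‖pairTerm q Y Z Y' Z' a b‖
      = ρ ^ (b.choose 2 + (a * Y + b * Y') * (a * Z + b * Z')) * ‖1 - q ^ b + q ^ (a + b)‖ *
        (‖qPoch q q a‖⁻¹ * ‖qPoch q q b‖⁻¹) := by
        rw [pairTerm, norm_div, norm_mul, norm_mul, norm_pow, norm_neg, norm_one, one_pow, one_mul,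
          norm_pow, norm_mul, div_eq_mul_inv, mul_inv]
    _ ≤ ρ ^ ((a + b) * (a + b)) * 3 * (C ^ a * C ^ b) := by
        exact mul_le_mul (mul_le_mul (pow_le_pow_of_le_one hρ0 hq.le hexp) h3 (norm_nonneg _)
          (by positivity)) (mul_le_mul (hP a) (hP b) (by positivity) (by positivity))
          (by positivity) (by positivity)
    _ = 3 * (ρ ^ ((a + b) * (a + b)) * C ^ (a + b)) := by rw [pow_add C]; ring
    _ ≤ 3 * ((2 * C) ^ N * (1 / 2) ^ (a + b)) := mul_le_mul_of_nonneg_left (hG _) (by norm_num)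
    _ = _ := by rw [pow_add]; ring

/-! ### The terms of the right-hand side -/

theorem qBinom_add (q : ℂ) (a b : ℕ) :
    qBinom q ((a : ℤ) + b) a = qPoch q q (a + b) / (qPoch q q a * qPoch q q b) := by
  rw [qBinom, if_pos (by omega), show ((a : ℤ) + b - a) = b by ring, ← Nat.cast_add,
    Int.toNat_natCast, Int.toNat_natCast, Int.toNat_natCast]

theorem qBinom_left {q : ℂ} (hq : ‖q‖ < 1) {a b : ℕ} :
    qBinom q ((a : ℤ) + b - 1) a * (1 - q ^ (a + b)) =
      qPoch q q (a + b) * (1 - q ^ b) / (qPoch q q a * qPoch q q b) := by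
  rcases b with _ | b
  · rw [qBinom, if_neg (by omega)]; simp
  · have h1 := one_sub_pow_ne_zero hq b
    have h2 := qPoch_self_ne_zero hq a
    have h3 := qPoch_self_ne_zero hq b
    rw [show ((a : ℤ) + (b + 1 : ℕ) - 1) = a + b by push_cast; ring, qBinom_add, ← add_assoc,
      qPoch_self_succ, qPoch_self_succ]
    field_simp

theorem qBinom_right {q : ℂ} (hq : ‖q‖ < 1) {a b : ℕ} :
    qBinom q ((a : ℤ) + b - 1) (a - 1) * (1 - q ^ (a + b)) =
      qPoch q q (a + b) * (1 - q ^ a) / (qPoch q q a * qPoch q q b) := by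
  rcases a with _ | a
  · rw [qBinom, if_neg (by omega)]; simp
  · have h1 := one_sub_pow_ne_zero hq a
    have h2 := qPoch_self_ne_zero hq a
    have h3 := qPoch_self_ne_zero hq b
    rw [show (((a + 1 : ℕ) : ℤ) + b - 1) = a + b by push_cast; ring,
      show (((a + 1 : ℕ) : ℤ) - 1) = a by push_cast; ring, qBinom_add,
      show a + 1 + b = a + b + 1 by ring, qPoch_self_succ, qPoch_self_succ]
    field_simp

/-- After multiplication by `1 - q^(a+b)`, nonzero since `a + b > 0`, this is `(1 - q^b) + q^(a+2b)
(1 - q^a) = (1 - q^(a+b)) (1 - q^b + q^(a+b))`. -/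
theorem Q_one {q : ℂ} (hq : ‖q‖ < 1) {a b : ℕ} (hab : 0 < a + b) :
    Q q 1 ((a : ℤ) + b) a / qPoch q q (a + b) =
      (1 - q ^ b + q ^ (a + b)) / (qPoch q q a * qPoch q q b) := by
  obtain ⟨k, hk⟩ := Nat.exists_eq_add_of_le' hab
  have h1 : 1 - q ^ (a + b) ≠ 0 := by rw [hk]; exact one_sub_pow_ne_zero hq k
  have h2 := qPoch_self_ne_zero hq a
  have h3 := qPoch_self_ne_zero hq b
  have h4 := qPoch_self_ne_zero hq (a + b)
  have e1 : ((1 : ℤ) - 1) / 2 * ((a : ℤ) + b + a) = 0 := by norm_num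
  have e2 : ((1 : ℤ) + 1) / 2 * (2 * ((a : ℤ) + b) - a) = ((a + 2 * b : ℕ) : ℤ) := by
    push_cast; norm_num; ring
  rw [Q, e1, e2, zpow_zero, zpow_natCast, div_eq_iff h4]
  refine mul_right_cancel₀ h1 ?_
  rw [add_mul, one_mul, mul_assoc, qBinom_left hq, qBinom_right hq]
  field_simp
  ring

theorem Q_neg_one {q : ℂ} (hq : ‖q‖ < 1) {a b : ℕ} (hab : 0 < a + b) :
    Q q (-1) ((a : ℤ) + b) a / qPoch q q (a + b) =
      (1 - q ^ a + q ^ (a + b)) / (qPoch q q a * qPoch q q b) := by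
  obtain ⟨k, hk⟩ := Nat.exists_eq_add_of_le' hab
  have h1 : 1 - q ^ (a + b) ≠ 0 := by rw [hk]; exact one_sub_pow_ne_zero hq k
  have h2 := qPoch_self_ne_zero hq a
  have h3 := qPoch_self_ne_zero hq b
  have h4 := qPoch_self_ne_zero hq (a + b)
  have e1 : ((1 : ℤ) + -1) / 2 * (2 * ((a : ℤ) + b) - a) = 0 := by norm_num
  have e2 : ((1 : ℤ) - -1) / 2 * ((a : ℤ) + b + a) = ((2 * a + b : ℕ) : ℤ) := by
    push_cast; norm_num; ring
  rw [Q, e1, e2, zpow_zero, zpow_natCast, div_eq_iff h4]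
  refine mul_right_cancel₀ h1 ?_
  rw [add_mul, one_mul, mul_assoc, qBinom_left hq, qBinom_right hq]
  field_simp
  ring

theorem mul_sub_one_ediv_two (m : ℕ) : (m : ℤ) * (m - 1) / 2 = m.choose 2 := by
  refine Int.ediv_eq_of_eq_mul_left two_ne_zero ?_
  have h : ((m.choose 2 : ℕ) : ℚ) = m * (m - 1) / 2 := Nat.cast_choose_two ℚ m
  have : ((m * (m - 1) : ℤ) : ℚ) = ((m.choose 2 * 2 : ℤ) : ℚ) := by push_cast; rw [h]; ring
  exact_mod_cast this

/-- The `k`-th term of the right-hand side. -/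
noncomputable def rhsTerm (p₀ : ℚ) (q : ℂ) (k : ℕ) : ℂ :=
  (-1 : ℂ) ^ ((1 - (-1) ^ alpha p₀) / 2 * (k : ℤ)) *
    q ^ (k ^ 2 * (y p₀ (alpha p₀ + 1) + y p₀ (alpha p₀)) *
      (z p₀ (alpha p₀) + zPred p₀ (alpha p₀))) * (L p₀ q k / qPoch q q k)

theorem rhsTerm_even {p₀ : ℚ} {q : ℂ} (hq : ‖q‖ < 1) (hq0 : q ≠ 0) (hα : Even (alpha p₀)) {k : ℕ}
    (hk : 0 < k) :
    rhsTerm p₀ q k = ∑ x ∈ antidiagonal k,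
      pairTerm q (y p₀ (alpha p₀) + y p₀ (alpha p₀ + 1)) (zPred p₀ (alpha p₀) + z p₀ (alpha p₀))
        (y p₀ (alpha p₀ + 1)) (z p₀ (alpha p₀)) x.1 x.2 := by
  rw [← Finset.Nat.sum_antidiagonal_swap]
  simp only [Prod.fst_swap, Prod.snd_swap]
  rw [Finset.Nat.sum_antidiagonal_eq_sum_range_succ (fun b a => pairTerm q
    (y p₀ (alpha p₀) + y p₀ (alpha p₀ + 1)) (zPred p₀ (alpha p₀) + z p₀ (alpha p₀))
        (y p₀ (alpha p₀ + 1)) (z p₀ (alpha p₀)) a b), rhsTerm, L, sum_div, mul_sum]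
  refine sum_congr rfl fun b hb => ?_
  obtain ⟨a, rfl⟩ := Nat.exists_eq_add_of_le' (Nat.lt_succ_iff.mp (mem_range.mp hb))
  have hd : Delta (alpha p₀) ((a + b : ℕ) : ℤ) (((a + b : ℕ) : ℤ) - b) = (b.choose 2 : ℤ) := by
    rw [Delta, hα.neg_one_pow, ← mul_sub_one_ediv_two]
    norm_num
  rw [hd, hα.neg_one_pow, Nat.add_sub_cancel, mul_div_assoc, show (((a + b : ℕ) : ℤ) - b) = a by
    push_cast; ring, Nat.cast_add, Q_one hq hk, pairTerm]
  generalize y p₀ (alpha p₀) = y₀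
  generalize y p₀ (alpha p₀ + 1) = y₁
  generalize zPred p₀ (alpha p₀) = z₀
  generalize z p₀ (alpha p₀) = z₁
  have hpow : q ^ ((a + b) ^ 2 * (y₁ + y₀) * (z₁ + z₀)) *
      q ^ ((b : ℤ) ^ 2 * y₀ * z₀ - ((a : ℤ) + b) * b * (y₁ * z₀ + 2 * y₀ * z₀ + y₀ * z₁) +
        b.choose 2) =
      q ^ (b.choose 2 + (a * (y₀ + y₁) + b * y₁) * (a * (z₀ + z₁) + b * z₁)) := by
    rw [← zpow_natCast, ← zpow_natCast, ← zpow_add₀ hq0]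
    congr 1
    push_cast
    ring
  rw [← hpow]
  norm_num
  ring

/-- For odd `α` the index `m` of `L` is the first coordinate of the pair, not the second; the extra
sign `(-1)^k` turns `(-1)^m` into `(-1)^(k-m)`. -/
theorem rhsTerm_odd {p₀ : ℚ} {q : ℂ} (hq : ‖q‖ < 1) (hq0 : q ≠ 0) (hα : Odd (alpha p₀)) {k : ℕ}
    (hk : 0 < k) :
    rhsTerm p₀ q k = ∑ x ∈ antidiagonal k,
      pairTerm q (y p₀ (alpha p₀ + 1)) (z p₀ (alpha p₀))
        (y p₀ (alpha p₀) + y p₀ (alpha p₀ + 1)) (zPred p₀ (alpha p₀) + z p₀ (alpha p₀))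
        x.1 x.2 := by
  rw [Finset.Nat.sum_antidiagonal_eq_sum_range_succ (fun b a => pairTerm q
    (y p₀ (alpha p₀ + 1)) (z p₀ (alpha p₀)) (y p₀ (alpha p₀) + y p₀ (alpha p₀ + 1))
    (zPred p₀ (alpha p₀) + z p₀ (alpha p₀)) b a), rhsTerm, L, sum_div, mul_sum]
  refine sum_congr rfl fun b hb => ?_
  obtain ⟨a, rfl⟩ := Nat.exists_eq_add_of_le' (Nat.lt_succ_iff.mp (mem_range.mp hb))
  have hd : Delta (alpha p₀) ((a + b : ℕ) : ℤ) (((a + b : ℕ) : ℤ) - b) = (a.choose 2 : ℤ) := by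
    rw [Delta, hα.neg_one_pow, ← mul_sub_one_ediv_two]
    norm_num
  rw [hd, hα.neg_one_pow, Nat.add_sub_cancel, mul_div_assoc, show (((a + b : ℕ) : ℤ) - b) = a by
    push_cast; ring, Nat.cast_add, Q_neg_one hq hk, pairTerm]
  generalize y p₀ (alpha p₀) = y₀
  generalize y p₀ (alpha p₀ + 1) = y₁
  generalize zPred p₀ (alpha p₀) = z₀
  generalize z p₀ (alpha p₀) = z₁
  have hpow : q ^ ((a + b) ^ 2 * (y₁ + y₀) * (z₁ + z₀)) *
      q ^ ((b : ℤ) ^ 2 * y₀ * z₀ - ((a : ℤ) + b) * b * (y₁ * z₀ + 2 * y₀ * z₀ + y₀ * z₁) +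
        a.choose 2) =
      q ^ (a.choose 2 + (b * y₁ + a * (y₀ + y₁)) * (b * z₁ + a * (z₀ + z₁))) := by
    rw [← zpow_natCast, ← zpow_natCast, ← zpow_add₀ hq0]
    congr 1
    push_cast
    ring
  have hsign : (-1 : ℂ) ^ ((1 - -1) / 2 * ((a : ℤ) + b)) * (-1) ^ b = (-1) ^ a := by
    rw [show ((1 - -1) / 2 * ((a : ℤ) + b)) = ((a + b : ℕ) : ℤ) by push_cast; norm_num,
      zpow_natCast, pow_add, mul_assoc, ← mul_pow]
    simp
  rw [← hpow, ← hsign, add_comm b a, mul_comm (qPoch q q b)]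
  ring

end BetheRR

/-! ### One double series, grouped in two ways -/

theorem mainTheorem2 (p₀ : ℚ) (hp₀ : 1 ≤ p₀) (w : ℂ) (hw : w.re < 0) (q : ℂ)
    (hq : q = Complex.exp w) :
    Summable (fun l : ℕ => BetheRR.qPow w ((l : ℚ) ^ 2 / p₀) * BetheRR.V p₀ w l) ∧
    Summable (fun k : ℕ+ =>
      (-1 : ℂ) ^ ((1 - (-1) ^ BetheRR.alpha p₀) / 2 * (k : ℤ)) *
        q ^ ((k : ℕ) ^ 2 *
          (BetheRR.y p₀ (BetheRR.alpha p₀ + 1) + BetheRR.y p₀ (BetheRR.alpha p₀)) *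
          (BetheRR.z p₀ (BetheRR.alpha p₀) + BetheRR.zPred p₀ (BetheRR.alpha p₀))) *
        (BetheRR.L p₀ q k / BetheRR.qPoch q q k)) ∧
    ∑' l : ℕ, BetheRR.qPow w ((l : ℚ) ^ 2 / p₀) * BetheRR.V p₀ w l =
      1 + ∑' k : ℕ+,
        (-1 : ℂ) ^ ((1 - (-1) ^ BetheRR.alpha p₀) / 2 * (k : ℤ)) *
          q ^ ((k : ℕ) ^ 2 *
            (BetheRR.y p₀ (BetheRR.alpha p₀ + 1) + BetheRR.y p₀ (BetheRR.alpha p₀)) *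
            (BetheRR.z p₀ (BetheRR.alpha p₀) + BetheRR.zPred p₀ (BetheRR.alpha p₀))) *
          (BetheRR.L p₀ q k / BetheRR.qPoch q q k) := by
  have hq0 : q ≠ 0 := hq ▸ Complex.exp_ne_zero w
  have hq1 : ‖q‖ < 1 := by rw [hq, Complex.norm_exp]; exact Real.exp_lt_one_iff.mpr hw
  have hV := BetheRR.qPow_V hp₀ w
  rw [← hq] at hV
  obtain ⟨Y, Z, Y', Z', hY, hZ, hY', hZ', hleft, hright⟩ : ∃ Y Z Y' Z' : ℕ,
      0 < Y ∧ 0 < Z ∧ 0 < Y' ∧ 0 < Z' ∧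
      (∀ l, BetheRR.partialSum p₀ q (BetheRR.size p₀) l = BetheRR.pairSum q Y Z Y' Z' l) ∧
      ∀ k, 0 < k → BetheRR.rhsTerm p₀ q k =
        ∑ x ∈ antidiagonal k, BetheRR.pairTerm q Y Z Y' Z' x.1 x.2 := by
    have hy0 := BetheRR.y_pos p₀ hp₀ (BetheRR.alpha p₀)
    have hy1 := BetheRR.y_pos p₀ hp₀ (BetheRR.alpha p₀ + 1)
    -- Positivity of both final vectors gives convergence; the starting vector `(1, 0)` would not
    -- do.
    have hz1 : 0 < BetheRR.z p₀ (BetheRR.alpha p₀) := by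
      refine Nat.pos_of_ne_zero fun h => ?_
      have h1 := BetheRR.mul_zShift hp₀
      simp only [BetheRR.zShift, BetheRR.zPred, BetheRR.yPred, h] at h1
      rw [Nat.cast_zero, mul_zero] at h1
      exact hy1.ne (by exact_mod_cast h1)
    have hS := BetheRR.partialSum_eq hp₀ hq1 hq0 (le_refl (BetheRR.size p₀))
    rw [BetheRR.r_size, ← BetheRR.interp_yPred, BetheRR.interp_size, BetheRR.interp_size] at hS
    rcases Nat.even_or_odd (BetheRR.alpha p₀) with hα | hα
    · rw [if_neg (by rw [Nat.even_add_one, not_not]; exact hα)] at hS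
      exact ⟨_, _, _, _, Nat.add_pos_right (BetheRR.y p₀ (BetheRR.alpha p₀)) hy1,
        Nat.add_pos_right (BetheRR.zPred p₀ (BetheRR.alpha p₀)) hz1, hy1, hz1, fun l => congrFun hS l,
        fun k hk => BetheRR.rhsTerm_even hq1 hq0 hα hk⟩
    · rw [if_pos hα.add_one] at hS
      exact ⟨_, _, _, _, hy1, hz1, Nat.add_pos_right (BetheRR.y p₀ (BetheRR.alpha p₀)) hy1,
        Nat.add_pos_right (BetheRR.zPred p₀ (BetheRR.alpha p₀)) hz1, fun l => congrFun hS l,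
        fun k hk => BetheRR.rhsTerm_odd hq1 hq0 hα hk⟩
  have hsum := (BetheRR.summable_pairTerm hq1 hY hZ hY' hZ').hasSum
  have hl := BetheRR.hasSum_pairs hsum hY hY'
  have hk := BetheRR.hasSum_pairs hsum one_pos one_pos
  have hterm : ∀ k, 0 < k → BetheRR.rhsTerm p₀ q k =
      ∑ x ∈ BetheRR.pairs 1 1 k, BetheRR.pairTerm q Y Z Y' Z' x.1 x.2 := by
    intro k hk
    rw [hright k hk]
    refine sum_congr ?_ fun _ _ => rfl
    ext x
    rw [BetheRR.mem_pairs one_pos one_pos, HasAntidiagonal.mem_antidiagonal, mul_one, mul_one]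
  have hzero : ∑ x ∈ BetheRR.pairs 1 1 0, BetheRR.pairTerm q Y Z Y' Z' x.1 x.2 = 1 := by
    have : BetheRR.pairs 1 1 0 = {(0, 0)} := by decide
    rw [this, sum_singleton]
    simp [BetheRR.pairTerm, BetheRR.qPoch_zero]
  have hL : (fun l : ℕ => BetheRR.qPow w ((l : ℚ) ^ 2 / p₀) * BetheRR.V p₀ w l) =
      fun l => ∑ x ∈ BetheRR.pairs Y Y' l, BetheRR.pairTerm q Y Z Y' Z' x.1 x.2 := by
    funext l
    rw [hV, hleft]
    rfl
  have hR : (fun k : ℕ+ => BetheRR.rhsTerm p₀ q k) =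
      fun k : ℕ+ => ∑ x ∈ BetheRR.pairs 1 1 k, BetheRR.pairTerm q Y Z Y' Z' x.1 x.2 :=
    funext fun k => hterm k k.pos
  refine ⟨hL ▸ hl.summable, ?_, ?_⟩
  · change Summable fun k : ℕ+ => BetheRR.rhsTerm p₀ q k
    rw [hR]
    exact hk.summable.comp_injective PNat.coe_injective
  · change _ = 1 + ∑' k : ℕ+, BetheRR.rhsTerm p₀ q k
    rw [hR, hL, hl.tsum_eq, ← hk.tsum_eq, hk.summable.tsum_eq_zero_add, hzero,
      tsum_pnat_eq_tsum_succ
        (f := fun k => ∑ x ∈ BetheRR.pairs 1 1 k, BetheRR.pairTerm q Y Z Y' Z' x.1 x.2)]
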